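/- **Model.** $M$ access points (APs) with $N\ge 1$ antennas serve $K$ single-antenna users. A resource block has instants $1,\dots,\tau_c$; user $k$ sends its pilot at the instant $t_k\in\{1,\dots,\tau_p\}$, and $\mathcal P_k=\{i: t_i=t_k\}$ (so $k\in\mathcal P_k$). Put $\lambda=\tau_p+1$. The channel from user $k$ to AP $m$ is $\mathbf h_{mk}[\lambda]=\bar{\mathbf h}_{mk}e^{j\phi^{\lambda}_{mk}}+\mathbf R_{mk}^{1/2}\tilde{\mathbf h}_{mk}$, and at an instant $n$ it is $\mathbf h_{mk}[n]=\rho_k[\lambda-n]\,\mathbf h_{mk}[\lambda]+\bar\rho_k[\lambda-n]\,\bar{\mathbf f}_{mk}[n]$ with $\bar{\mathbf f}_{mk}[n]=\bar{\mathbf h}_{mk}e^{j\phi^{n}_{mk}}+\mathbf f_{mk}[n]$. Here $\tilde{\mathbf h}_{mk}\sim\mathcal{CN}(0,\mathbf I_N)$, $\mathbf f_{mk}[n]\sim\mathcal{CN}(0,\mathbf R_{mk})$, the phases are uniform on $[-\pi,\pi]$, all these variables are independent, $\rho_k[d]=J_0(2\pi f_{D,k}T_s d)$ with $f_{D,k}=v_kf_c/c$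 (Jakes' model), $\bar\rho_k=\sqrt{1-\rho_k^2}$, $\bar{\mathbf h}_{mk}=\sqrt{K_{mk}\beta_{mk}/(K_{mk}+1)}\,[1,e^{j\psi_{mk}},\dots,e^{j(N-1)\psi_{mk}}]^T$, and $\mathbf R_{mk}=\frac{\beta_{mk}}{K_{mk}+1}\breve{\mathbf R}_{mk}$ with $K_{mk}\ge0$, $\beta_{mk}>0$, $\breve{\mathbf R}_{mk}\succeq 0$. A user $i$ with signal $s$ of power $q_i$ (pilot: $s=\sqrt{\tilde p_i}$, $q_i=\tilde p_i\ge0$; data: $q_i=p_i\ge0$) radiates $\alpha_{d,i}s+\upsilon_i+\xi_i$ with DAC gain $\alpha_{d,i}=1-\iota_{d,i}$, DAC noise $\upsilon_i$ of variance $\alpha_{d,i}(1-\alpha_{d,i})q_i$ and RF distortion $\xi_i\sim\mathcal{CN}(0,\kappa_{t,i}^2\alpha_{d,i}q_i)$. From the sum $\mathbf y_m$ of the signals received at AP $m$ at an instant $n$ ($n=t_k$ for the users in $\mathcal P_k$ in training, all users in data transmission), AP $m$ obtains $\mathbf A_m(\mathbf y_m+\boldsymbol\eta_m+\mathbf z_m)+\mathbf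 n_m$, where $\mathbf A_m=\mathrm{diag}(1-\iota_{m,1},\dots,1-\iota_{m,N})$, $\mathbf z_m\sim\mathcal{CN}(0,\sigma^2\mathbf I_N)$ with $\sigma^2>0$, and, given the channels, $\boldsymbol\eta_m\sim\mathcal{CN}(0,\kappa_{r,m}^2\mathbf W_m)$ and the zero-mean ADC noise $\mathbf n_m$ has covariance $\mathbf B_m((1+\kappa_{r,m}^2)\mathbf W_m+\sigma^2\mathbf I_N)$, with $\mathbf B_m=\mathbf A_m(\mathbf I_N-\mathbf A_m)$ and $\mathbf W_m=\sum_i(1+\kappa_{t,i}^2)\alpha_{d,i}q_i\,\mathrm{diag}(\mathbf h_{mi}[n]\mathbf h_{mi}^H[n])$. After normalization by their conditional standard deviations, all distortions and noises are independent of each other and of the channels, at all instants. Let $\mathbf y^p_{mk}$ be the quantized pilot signal at AP $m$ and instant $t_k$, and let $\hat{\mathbf h}_{mk}=\mathbb E\{\mathbf h_{mk}[\lambda](\mathbf y^p_{mk})^H\}\,\mathbb E\{\mathbf y^p_{mk}(\mathbf y^p_{mk})^H\}^{-1}\mathbf y^p_{mk}$ be the LMMSE estimate of $\mathbf h_{mk}[\lambda]$.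 For a data instant $\lambda\le n\le\tau_c$ and arbitrary complex LSFD weights $a_{mk}[n]$, the use-and-then-forget SINR is $$\overline{\mathrm{SINR}}_{k,n}=\frac{|\mathrm{DS}|^2}{\mathbb E|\mathrm{BU}|^2+\mathbb E|\mathrm{CA}|^2+\sum_{i\ne k}\mathbb E|\mathrm{IUI}_i|^2+\mathbb E|\mathrm{DAC}|^2+\mathbb E|\mathrm{TRF}|^2+\mathbb E|\mathrm{RRF}|^2+\mathbb E|\mathrm{ADC}|^2+\mathbb E|\mathrm{NS}|^2},$$ where, with $g_m=\hat{\mathbf h}_{mk}^H\mathbf A_m\mathbf h_{mk}[\lambda]$, $\langle\mathbf x\rangle=\sum_m a_{mk}^*[n]\hat{\mathbf h}_{mk}^H\mathbf x_m$ for a family $\mathbf x=(\mathbf x_m)_m$ of vectors, and all distortions and noises taken at the data instant $n$: $\mathrm{DS}=\sum_m a_{mk}^*[n]\alpha_{d,k}\rho_k[n-\lambda]\sqrt{p_k}\,\mathbb E g_m$, $\mathrm{BU}=\sum_m a_{mk}^*[n]\alpha_{d,k}\rho_k[n-\lambda]\sqrt{p_k}(g_m-\mathbb E g_m)$, $\mathrm{CA}=\alpha_{d,k}\bar\rho_k[n-\lambda]\sqrt{p_k}\langle\mathbf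 A_m\bar{\mathbf f}_{mk}[n]\rangle$, $\mathrm{IUI}_i=\alpha_{d,i}\sqrt{p_i}\langle\mathbf A_m\mathbf h_{mi}[n]\rangle$, $\mathrm{DAC}=\langle\mathbf A_m\sum_i\mathbf h_{mi}[n]\upsilon_i\rangle$, $\mathrm{TRF}=\langle\mathbf A_m\sum_i\mathbf h_{mi}[n]\xi_i\rangle$, $\mathrm{RRF}=\langle\mathbf A_m\boldsymbol\eta_m\rangle$, $\mathrm{ADC}=\langle\mathbf n_m\rangle$, $\mathrm{NS}=\langle\mathbf A_m\mathbf z_m\rangle$. With $\bar{\mathbf R}_{mk}=\bar{\mathbf h}_{mk}\bar{\mathbf h}_{mk}^H+\mathbf R_{mk}$, let $\overline{\boldsymbol\Gamma}_{mk}=\alpha_{d,k}^2\tilde p_k\rho_k^2[\lambda-t_k]\,\bar{\mathbf R}_{mk}\mathbf A_m\boldsymbol\Psi_{mk}\mathbf A_m\bar{\mathbf R}_{mk}$, where $$\boldsymbol\Psi_{mk}=\Big(\sum_{i\in\mathcal P_k}\alpha_{d,i}(1+\kappa_{t,i}^2)\tilde p_i\big(\mathbf A_m\bar{\mathbf R}_{mi}\mathbf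 A_m^H+(\mathbf B_m+\kappa_{r,m}^2\mathbf A_m)\,\mathrm{diag}(\bar{\mathbf R}_{mi})\big)+\sigma^2\mathbf A_m\Big)^{-1}.$$ Put $\overline\gamma_{mk}=\frac1N\mathrm{tr}(\overline{\boldsymbol\Gamma}_{mk})$. **Statement.** Let $K_{mk}=0$ and $\mathbf R_{mk}=\beta_{mk}\mathbf I_N$ for all $m,k$, let the RF chains be ideal ($\kappa_{t,k}=\kappa_{r,m}=0$), and let the ADCs and DACs have infinite resolution ($\iota_{d,k}=0$, $\iota_{m,b}=0$). Then all the expectations above exist, the inverted covariance matrices are invertible, and (a) $$\overline{\mathrm{SINR}}_{k,n}=\frac{p_k\rho_k^2[n-\lambda]\big|\sum_m a_{mk}^*[n]N\overline\gamma_{mk}\big|^2}{\sum_{i=1}^K\sum_m|a_{mk}[n]|^2p_iN\overline\gamma_{mk}\beta_{mi}+N^2\sum_{i\in\mathcal P_k\setminus\{k\}}p_i\rho_i^2[n-\lambda]\big|\sum_m a_{mk}^*[n]\sqrt{\overline\gamma_{mk}\overline\gamma_{mi}}\big|^2+\sigma^2\sum_m|a_{mk}[n]|^2N\overline\gamma_{mk}}.$$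 (b) The right-hand side of (a) coincides with the known closed-form SINR for aging correlated Rayleigh channels with ideal hardware, $$\frac{\rho_k^2[n-\lambda]p_k\big|\sum_m a_{mk}^*[n]\,\mathrm{tr}\,\mathbf Q_{mk}\big|^2}{\sum_i p_i\sum_m|a_{mk}[n]|^2\,\mathrm{tr}(\mathbf Q_{mk}\mathbf R_{mi})+\sum_{i\in\mathcal P_k\setminus\{k\}}\rho_i^2[n-\lambda]p_i\big|\sum_m a_{mk}^*[n]\,\mathrm{tr}\,\bar{\mathbf Q}_{mki}\big|^2+\sigma^2\sum_m|a_{mk}[n]|^2\,\mathrm{tr}\,\mathbf Q_{mk}},$$ evaluated at $\mathbf R_{mk}=\beta_{mk}\mathbf I_N$, where $\bar{\mathbf Q}_{mki}=\sqrt{\tilde p_k\tilde p_i}\,\rho_k[\lambda-t_k]\rho_i[\lambda-t_i]\,\mathbf R_{mi}\big(\sum_{j\in\mathcal P_k}\tilde p_j\mathbf R_{mj}+\sigma^2\mathbf I_N\big)^{-1}\mathbf R_{mk}$ and $\mathbf Q_{mk}=\bar{\mathbf Q}_{mkk}$. (c) Suppose moreover that $N=1$, that $\rho_i[n-\lambda]=1$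 for all $i$ (and, if $n=\lambda$, also $\rho_i[\lambda-t_i]=1$ for all $i$), and that the LSFD weights are uniform, $a_{mk}[n]=1/L$ for all $m$ with a real constant $L\ne0$. Write $p_i=\sigma^2\rho_u\eta_i$ and let the pilot energies be equal, $\tilde p_i=\sigma^2\tau_p\rho_p$. Let $\varphi_1,\dots,\varphi_K\in\mathbb C^{\tau_p}$ be unit-norm pilot sequences from an orthonormal family such that two users have the same sequence exactly when they share a pilot instant. Then the right-hand side of (a) equals the uplink cell-free SINR of Ngo et al., $$\frac{\rho_u\eta_k\big(\sum_m\gamma_{mk}\big)^2}{\rho_u\sum_{i\ne k}\eta_i\big(\sum_m\gamma_{mk}\frac{\beta_{mi}}{\beta_{mk}}\big)^2|\varphi_k^H\varphi_i|^2+\rho_u\sum_i\eta_i\sum_m\gamma_{mk}\beta_{mi}+\sum_m\gamma_{mk}},\qquad \gamma_{mk}=\frac{\tau_p\rho_p\beta_{mk}^2}{\tau_p\rho_p\sum_i\beta_{mi}|\varphi_k^H\varphi_i|^2+1}.$$ Here a ratio $0/0$ is read as $0$. -/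

import Mathlib

open MeasureTheory ProbabilityTheory Matrix
open scoped ComplexOrder MatrixOrder BigOperators

noncomputable section

/-! Uplink of a cell-free massive MIMO system with channel aging, Rician fading with random
line-of-sight phases, hardware-impaired RF chains, low-resolution DACs (users) and
dynamic-resolution ADCs (access points), and two-layer (LSFD) decoding. -/

/-- Bessel function of the first kind of order zero (Bessel's integral). -/
def besselJ0 (x : ℝ) : ℝ := Real.pi⁻¹ * ∫ θ in (0 : ℝ)..Real.pi, Real.cos (x * Real.sin θ)

/-- The standard circularly symmetric complex Gaussian law `CN(0,1)`: independent real and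
imaginary parts, each of variance `1/2`. -/
def stdComplexGaussian : Measure ℂ :=
  ((gaussianReal 0 (1 / 2)).prod (gaussianReal 0 (1 / 2))).map
    (fun x : ℝ × ℝ => (⟨x.1, x.2⟩ : ℂ))

/-- The law of `exp(jφ)` with `φ` uniform on `[-π, π]`. -/
def uniformPhasor : Measure ℂ :=
  (ProbabilityTheory.cond volume (Set.Icc (-Real.pi) Real.pi)).map
    (fun φ : ℝ => Complex.exp (φ * Complex.I))

/-- Deterministic parameters: `M` access points (APs) with `N` antennas each, `K` users. -/
structure CFParams (M K N : ℕ) where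
  /-- number of training instants -/
  τp : ℕ
  /-- length of the resource block -/
  τc : ℕ
  /-- position of the pilot instant of each user inside the training interval -/
  pilotIdx : Fin K → Fin τp
  /-- user velocities -/
  v : Fin K → ℝ
  /-- carrier frequency -/
  fc : ℝ
  /-- velocity of light -/
  c : ℝ
  /-- sampling time -/
  Ts : ℝ
  /-- Rician factors -/
  rician : Fin M → Fin K → ℝ
  /-- large-scale fading coefficients -/
  β : Fin M → Fin K → ℝ
  /-- angles of arrival of the line-of-sight paths -/
  ψ : Fin M → Fin K → ℝ
  /-- spatial correlation matrices -/
  Rcorr : Fin M → Fin K → Matrix (Fin N) (Fin N) ℂ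
  /-- DAC distortion factors of the users (`0` for infinite resolution) -/
  ιd : Fin K → ℝ
  /-- ADC distortion factors of the AP antennas (`0` for infinite resolution) -/
  ιa : Fin M → Fin N → ℝ
  /-- transmit EVMs of the users (`0` for an ideal RF chain) -/
  κt : Fin K → ℝ
  /-- receive EVMs of the APs (`0` for ideal RF chains) -/
  κr : Fin M → ℝ
  /-- data powers -/
  p : Fin K → ℝ
  /-- pilot powers -/
  pp : Fin K → ℝ
  /-- standard deviation of the receiver noise -/
  σ : ℝ

namespace CFParams

variable {M K N : ℕ} (par : CFParams M K N)

/-- The physically meaningful range of the parameters. -/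
structure Admissible : Prop where
  c_pos : 0 < par.c
  rician_nonneg : ∀ m k, 0 ≤ par.rician m k
  β_pos : ∀ m k, 0 < par.β m k
  Rcorr_psd : ∀ m k, (par.Rcorr m k).PosSemidef
  ιd_mem : ∀ k, 0 ≤ par.ιd k ∧ par.ιd k < 1
  ιa_mem : ∀ m b, 0 ≤ par.ιa m b ∧ par.ιa m b < 1
  κt_nonneg : ∀ k, 0 ≤ par.κt k
  κr_nonneg : ∀ m, 0 ≤ par.κr m
  p_nonneg : ∀ k, 0 ≤ par.p k
  pp_nonneg : ∀ k, 0 ≤ par.pp k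
  σ_pos : 0 < par.σ

/-- The instant `t_k ∈ {1, …, τ_p}` at which user `k` sends its pilot. -/
def t (k : Fin K) : ℕ := (par.pilotIdx k : ℕ) + 1

/-- The instant `λ = τ_p + 1` whose channel is estimated. -/
def lam : ℕ := par.τp + 1

/-- The set `P_k` of users that send their pilot at the instant `t_k` (it contains `k`). -/
def copilot (k : Fin K) : Finset (Fin K) :=
  Finset.univ.filter (fun i => par.pilotIdx i = par.pilotIdx k)

/-- Temporal correlation (Jakes' model) at time lag `d`. -/
def ρ (k : Fin K) (d : ℤ) : ℝ :=
  besselJ0 (2 * Real.pi * (par.v k * par.fc / par.c) * par.Ts * d)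

def ρbar (k : Fin K) (d : ℤ) : ℝ := Real.sqrt (1 - par.ρ k d ^ 2)

/-- Line-of-sight component: `√(Kβ/(K+1)) [1, e^{jψ}, …, e^{j(N-1)ψ}]ᵀ`. -/
def hbar (m : Fin M) (k : Fin K) : Fin N → ℂ := fun b =>
  (Real.sqrt (par.rician m k * par.β m k / (par.rician m k + 1)) : ℂ) *
    Complex.exp (((b : ℕ) : ℂ) * (par.ψ m k : ℂ) * Complex.I)

/-- Covariance of the non-line-of-sight component: `β/(K+1)` times the correlation matrix. -/
def R (m : Fin M) (k : Fin K) : Matrix (Fin N) (Fin N) ℂ :=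
  ((par.β m k / (par.rician m k + 1) : ℝ) : ℂ) • par.Rcorr m k

/-- `E[h hᴴ] = h̄ h̄ᴴ + R`. -/
def Rbar (m : Fin M) (k : Fin K) : Matrix (Fin N) (Fin N) ℂ :=
  vecMulVec (par.hbar m k) (star (par.hbar m k)) + par.R m k

/-- Bussgang gain of the DAC of user `k`. -/
def αd (k : Fin K) : ℝ := 1 - par.ιd k

/-- Bussgang gains of the ADCs of AP `m`. -/
def A (m : Fin M) : Matrix (Fin N) (Fin N) ℂ :=
  diagonal fun b => ((1 - par.ιa m b : ℝ) : ℂ)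

/-- `B_m = A_m (I - A_m)`. -/
def B (m : Fin M) : Matrix (Fin N) (Fin N) ℂ := par.A m * (1 - par.A m)

/-- `J = ∑_{j ∈ P_k} (1 + κ_{t,j}²) α_{d,j} p̃_j diag(R̄_{mj})`. -/
def J (m : Fin M) (k : Fin K) : Matrix (Fin N) (Fin N) ℂ :=
  ∑ j ∈ par.copilot k, (((1 + par.κt j ^ 2) * par.αd j * par.pp j : ℝ) : ℂ) •
    diagonal (par.Rbar m j).diag

/-- Inverse covariance of the quantized pilot signal at AP `m` and instant `t_k`. -/
def Ψ (m : Fin M) (k : Fin K) : Matrix (Fin N) (Fin N) ℂ :=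
  (∑ i ∈ par.copilot k, ((par.αd i * (1 + par.κt i ^ 2) * par.pp i : ℝ) : ℂ) •
      (par.A m * par.Rbar m i * (par.A m)ᴴ)
    + (par.B m + ((par.κr m ^ 2 : ℝ) : ℂ) • par.A m) * par.J m k
    + ((par.σ ^ 2 : ℝ) : ℂ) • par.A m)⁻¹

/-- Covariance `Γ̄_{mk} = α_{d,k}² p̃_k ρ_k[λ-t_k]² R̄ A Ψ A R̄` of the channel estimate. -/
def Γbar (m : Fin M) (k : Fin K) : Matrix (Fin N) (Fin N) ℂ :=
  ((par.αd k ^ 2 * par.pp k * par.ρ k ((par.lam : ℤ) - par.t k) ^ 2 : ℝ) : ℂ) •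
    (par.Rbar m k * par.A m * par.Ψ m k * par.A m * par.Rbar m k)

/-- Per-antenna power `γ̄_{mk} = tr(Γ̄_{mk}) / N` of the channel estimate. -/
def γbar (m : Fin M) (k : Fin K) : ℝ := (par.Γbar m k).trace.re / N

/-- Uncorrelated Rayleigh fading, ideal RF chains, infinite-resolution ADCs and DACs. -/
structure IdealRayleigh : Prop where
  rician_zero : ∀ m k, par.rician m k = 0
  uncorrelated : ∀ m k, par.R m k = (par.β m k : ℂ) • (1 : Matrix (Fin N) (Fin N) ℂ)
  transmit_rf : ∀ k, par.κt k = 0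
  receive_rf : ∀ m, par.κr m = 0
  dac : ∀ k, par.ιd k = 0
  adc : ∀ m b, par.ιa m b = 0

end CFParams

/-- Index set of the primitive (normalized) scalar random variables. -/
inductive Src (M K N : ℕ) : Type
  /-- small-scale fading at the instant `λ` -/
  | nlos (m : Fin M) (k : Fin K) (b : Fin N)
  /-- phasor `e^{jφ}` of the line-of-sight path at an instant -/
  | phasor (m : Fin M) (k : Fin K) (n : ℕ)
  /-- innovation at an instant -/
  | innov (m : Fin M) (k : Fin K) (n : ℕ) (b : Fin N)
  /-- DAC quantization noise -/
  | dac (k : Fin K) (n : ℕ)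
  /-- transmit RF distortion -/
  | txRF (k : Fin K) (n : ℕ)
  /-- receive RF distortion -/
  | rxRF (m : Fin M) (n : ℕ) (b : Fin N)
  /-- receiver noise -/
  | awgn (m : Fin M) (n : ℕ) (b : Fin N)
  /-- ADC quantization noise -/
  | adc (m : Fin M) (n : ℕ) (b : Fin N)

/-- Laws of the primitive random variables. The quantization noises are only prescribed up to
second order. -/
structure IsSourceFamily {M K N : ℕ} {Ω : Type*} [MeasurableSpace Ω] (P : Measure Ω)
    (X : Src M K N → Ω → ℂ) : Prop where
  measurable : ∀ s, Measurable (X s)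
  indep : iIndepFun X P
  nlos : ∀ m k b, P.map (X (.nlos m k b)) = stdComplexGaussian
  phasor : ∀ m k n, P.map (X (.phasor m k n)) = uniformPhasor
  innov : ∀ m k n b, P.map (X (.innov m k n b)) = stdComplexGaussian
  txRF : ∀ k n, P.map (X (.txRF k n)) = stdComplexGaussian
  rxRF : ∀ m n b, P.map (X (.rxRF m n b)) = stdComplexGaussian
  awgn : ∀ m n b, P.map (X (.awgn m n b)) = stdComplexGaussian
  dac : ∀ k n, MemLp (X (.dac k n)) 2 P ∧ ∫ ω, X (.dac k n) ω ∂P = 0 ∧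
    ∫ ω, ‖X (.dac k n) ω‖ ^ 2 ∂P = 1
  adc : ∀ m n b, MemLp (X (.adc m n b)) 2 P ∧ ∫ ω, X (.adc m n b) ω ∂P = 0 ∧
    ∫ ω, ‖X (.adc m n b) ω‖ ^ 2 ∂P = 1

namespace CFParams

variable {M K N : ℕ} (par : CFParams M K N) {Ω : Type*} (X : Src M K N → Ω → ℂ)

/-- Channel at the instant `λ`: `h̄ e^{jφ} + R^{1/2} h̃`. -/
def chanLam (m : Fin M) (k : Fin K) (ω : Ω) : Fin N → ℂ :=
  X (.phasor m k par.lam) ω • par.hbar m k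
    + CFC.sqrt (par.R m k) *ᵥ (fun b => X (.nlos m k b) ω)

/-- Innovation at the instant `n`: `h̄ e^{jφ} + f` with `f ∼ CN(0, R)`. -/
def innovation (m : Fin M) (k : Fin K) (n : ℕ) (ω : Ω) : Fin N → ℂ :=
  X (.phasor m k n) ω • par.hbar m k
    + CFC.sqrt (par.R m k) *ᵥ (fun b => X (.innov m k n b) ω)

/-- Aged channel at the instant `n` (at `n = λ` it is `chanLam`, as `ρ_k[0] = 1`). -/
def chan (m : Fin M) (k : Fin K) (n : ℕ) (ω : Ω) : Fin N → ℂ :=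
  (par.ρ k ((par.lam : ℤ) - n) : ℂ) • par.chanLam X m k ω
    + (par.ρbar k ((par.lam : ℤ) - n) : ℂ) • par.innovation X m k n ω

/-- DAC quantization noise of user `k` at instant `n` for input power `q`
(variance `α(1-α)q`). -/
def dacNoise (q : ℝ) (k : Fin K) (n : ℕ) (ω : Ω) : ℂ :=
  (Real.sqrt (par.αd k * (1 - par.αd k) * q) : ℂ) * X (.dac k n) ω

/-- Transmit RF distortion of user `k` at instant `n` for DAC input power `q`
(variance `κ_t²` times the DAC output power `αq`). -/
def txDistortion (q : ℝ) (k : Fin K) (n : ℕ) (ω : Ω) : ℂ :=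
  (par.κt k * Real.sqrt (par.αd k * q) : ℂ) * X (.txRF k n) ω

/-- Received power, given the channels, at antenna `b` of AP `m` and instant `n` when the
users in `U` transmit with powers `q`. -/
def rxPower (U : Finset (Fin K)) (q : Fin K → ℝ) (m : Fin M) (n : ℕ) (b : Fin N) (ω : Ω) : ℝ :=
  ∑ j ∈ U, (1 + par.κt j ^ 2) * par.αd j * q j * ‖par.chan X m j n ω b‖ ^ 2

/-- Receive RF distortion, `CN(0, κ_r² W)` given the channels. -/
def rxDistortion (U : Finset (Fin K)) (q : Fin K → ℝ) (m : Fin M) (n : ℕ) (ω : Ω) :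
    Fin N → ℂ := fun b =>
  (par.κr m * Real.sqrt (par.rxPower X U q m n b ω) : ℂ) * X (.rxRF m n b) ω

/-- Receiver noise, `CN(0, σ² I)`. -/
def noise (m : Fin M) (n : ℕ) (ω : Ω) : Fin N → ℂ := fun b => (par.σ : ℂ) * X (.awgn m n b) ω

/-- ADC quantization noise, of covariance `B ((1 + κ_r²) W + σ² I)` given the channels. -/
def adcNoise (U : Finset (Fin K)) (q : Fin K → ℝ) (m : Fin M) (n : ℕ) (ω : Ω) :
    Fin N → ℂ := fun b =>
  (Real.sqrt ((1 - par.ιa m b) * (1 - (1 - par.ιa m b)) *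
    ((1 + par.κr m ^ 2) * par.rxPower X U q m n b ω + par.σ ^ 2)) : ℂ) * X (.adc m n b) ω

/-- Effective pilot signal of user `i`. -/
def pilot (i : Fin K) (ω : Ω) : ℂ :=
  (par.αd i * Real.sqrt (par.pp i) : ℂ) + par.dacNoise X (par.pp i) i (par.t i) ω
    + par.txDistortion X (par.pp i) i (par.t i) ω

/-- Quantized pilot signal at AP `m` and instant `t_k`. -/
def yPilot (m : Fin M) (k : Fin K) (ω : Ω) : Fin N → ℂ :=
  par.A m *ᵥ ((∑ i ∈ par.copilot k, par.pilot X i ω • par.chan X m i (par.t k) ω)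
      + par.rxDistortion X (par.copilot k) par.pp m (par.t k) ω
      + par.noise X m (par.t k) ω)
    + par.adcNoise X (par.copilot k) par.pp m (par.t k) ω

variable [MeasurableSpace Ω] (P : Measure Ω)

/-- `E[h_{mk}[λ] yᴴ]`, with `y` the quantized pilot signal at AP `m` and instant `t_k`. -/
def Chy (m : Fin M) (k : Fin K) : Matrix (Fin N) (Fin N) ℂ :=
  of fun b b' => ∫ ω, par.chanLam X m k ω b * star (par.yPilot X m k ω b') ∂P

/-- `E[y yᴴ]`. -/
def Cyy (m : Fin M) (k : Fin K) : Matrix (Fin N) (Fin N) ℂ :=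
  of fun b b' => ∫ ω, par.yPilot X m k ω b * star (par.yPilot X m k ω b') ∂P

/-- LMMSE estimate of the channel at the instant `λ`. -/
def hhat (m : Fin M) (k : Fin K) (ω : Ω) : Fin N → ℂ :=
  (par.Chy X P m k * (par.Cyy X P m k)⁻¹) *ᵥ par.yPilot X m k ω

/-- `∑_m a_m^* ĥ_{mk}ᴴ[λ] g_m`: the two-layer combination, for user `k` with LSFD weights
`a_m = a_{mk}[n]`, of the vectors `g_m` received at the APs. -/
def combine (a : Fin M → ℂ) (k : Fin K) (g : Fin M → Ω → Fin N → ℂ) (ω : Ω) : ℂ :=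
  ∑ m, star (a m) * (star (par.hhat X P m k ω) ⬝ᵥ g m ω)

/-- Gain of the estimated channel, `E[ĥ_{mk}ᴴ[λ] A_m h_{mk}[λ]]`. -/
def meanGain (m : Fin M) (k : Fin K) : ℂ :=
  ∫ ω, star (par.hhat X P m k ω) ⬝ᵥ (par.A m *ᵥ par.chanLam X m k ω) ∂P

/-- Coefficient of the desired symbol. -/
def sigDS (a : Fin M → ℂ) (k : Fin K) (n : ℕ) : ℂ :=
  ∑ m, star (a m) *
    (par.αd k * par.ρ k ((n : ℤ) - par.lam) * Real.sqrt (par.p k) : ℂ) * par.meanGain X P m k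

/-- Beamforming uncertainty. -/
def sigBU (a : Fin M → ℂ) (k : Fin K) (n : ℕ) (ω : Ω) : ℂ :=
  ∑ m, star (a m) *
    (par.αd k * par.ρ k ((n : ℤ) - par.lam) * Real.sqrt (par.p k) : ℂ) *
      (star (par.hhat X P m k ω) ⬝ᵥ (par.A m *ᵥ par.chanLam X m k ω) - par.meanGain X P m k)

/-- Channel aging. -/
def sigCA (a : Fin M → ℂ) (k : Fin K) (n : ℕ) (ω : Ω) : ℂ :=
  (par.αd k * par.ρbar k ((n : ℤ) - par.lam) * Real.sqrt (par.p k) : ℂ) *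
    par.combine X P a k (fun m ω => par.A m *ᵥ par.innovation X m k n ω) ω

/-- Interference of user `i`. -/
def sigIUI (a : Fin M → ℂ) (k i : Fin K) (n : ℕ) (ω : Ω) : ℂ :=
  (par.αd i * Real.sqrt (par.p i) : ℂ) *
    par.combine X P a k (fun m ω => par.A m *ᵥ par.chan X m i n ω) ω

/-- DAC impairment of the users. -/
def sigDAC (a : Fin M → ℂ) (k : Fin K) (n : ℕ) (ω : Ω) : ℂ :=
  par.combine X P a k
    (fun m ω => par.A m *ᵥ ∑ i, par.dacNoise X (par.p i) i n ω • par.chan X m i n ω) ω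

/-- Transmit RF impairment of the users. -/
def sigTRF (a : Fin M → ℂ) (k : Fin K) (n : ℕ) (ω : Ω) : ℂ :=
  par.combine X P a k
    (fun m ω => par.A m *ᵥ ∑ i, par.txDistortion X (par.p i) i n ω • par.chan X m i n ω) ω

/-- Receive RF impairment of the APs. -/
def sigRRF (a : Fin M → ℂ) (k : Fin K) (n : ℕ) (ω : Ω) : ℂ :=
  par.combine X P a k
    (fun m ω => par.A m *ᵥ par.rxDistortion X Finset.univ par.p m n ω) ω

/-- ADC impairment of the APs. -/
def sigADC (a : Fin M → ℂ) (k : Fin K) (n : ℕ) (ω : Ω) : ℂ :=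
  par.combine X P a k (fun m ω => par.adcNoise X Finset.univ par.p m n ω) ω

/-- Combined receiver noise. -/
def sigNS (a : Fin M → ℂ) (k : Fin K) (n : ℕ) (ω : Ω) : ℂ :=
  par.combine X P a k (fun m ω => par.A m *ᵥ par.noise X m n ω) ω

/-- Mean power `E|Y|²`. -/
def power (Y : Ω → ℂ) : ℝ := ∫ ω, ‖Y ω‖ ^ 2 ∂P

/-- The use-and-then-forget SINR of user `k` at instant `n` for LSFD weights `a_m = a_{mk}[n]`. -/
def sinr (a : Fin M → ℂ) (k : Fin K) (n : ℕ) : ℝ :=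
  ‖par.sigDS X P a k n‖ ^ 2 /
    (power P (par.sigBU X P a k n) + power P (par.sigCA X P a k n)
      + ∑ i ∈ Finset.univ.erase k, power P (par.sigIUI X P a k i n)
      + power P (par.sigDAC X P a k n) + power P (par.sigTRF X P a k n)
      + power P (par.sigRRF X P a k n) + power P (par.sigADC X P a k n)
      + power P (par.sigNS X P a k n))

/-- All expectations that enter the LMMSE estimates and the SINR exist, and the covariances that
are inverted are invertible. -/
structure SinrWellDefined (a : Fin M → ℂ) (k : Fin K) (n : ℕ) : Prop where
  chan : ∀ m b, MemLp (fun ω => par.chanLam X m k ω b) 2 P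
  pilot : ∀ m b, MemLp (fun ω => par.yPilot X m k ω b) 2 P
  cov : ∀ m, IsUnit (par.Cyy X P m k).det
  gain : ∀ m, Integrable
    (fun ω => star (par.hhat X P m k ω) ⬝ᵥ (par.A m *ᵥ par.chanLam X m k ω)) P
  bu : MemLp (par.sigBU X P a k n) 2 P
  ca : MemLp (par.sigCA X P a k n) 2 P
  iui : ∀ i, i ≠ k → MemLp (par.sigIUI X P a k i n) 2 P
  dac : MemLp (par.sigDAC X P a k n) 2 P
  trf : MemLp (par.sigTRF X P a k n) 2 P
  rrf : MemLp (par.sigRRF X P a k n) 2 P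
  adc : MemLp (par.sigADC X P a k n) 2 P
  ns : MemLp (par.sigNS X P a k n) 2 P

/-- The explicit SINR for uncorrelated Rayleigh fading and ideal hardware. -/
def idealSinr (a : Fin M → ℂ) (k : Fin K) (n : ℕ) : ℝ :=
  (par.p k * par.ρ k ((n : ℤ) - par.lam) ^ 2 *
      ‖∑ m, star (a m) * ((N * par.γbar m k : ℝ) : ℂ)‖ ^ 2) /
    (∑ i, ∑ m, ‖star (a m)‖ ^ 2 * par.p i * N * par.γbar m k * par.β m i
      + (N : ℝ) ^ 2 * ∑ i ∈ (par.copilot k).erase k,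
          par.p i * par.ρ i ((n : ℤ) - par.lam) ^ 2 *
            ‖∑ m, star (a m) * (Real.sqrt (par.γbar m k * par.γbar m i) : ℂ)‖ ^ 2
      + par.σ ^ 2 * ∑ m, ‖star (a m)‖ ^ 2 * N * par.γbar m k)

end CFParams

/-! Closed-form SINR known for aging, spatially correlated Rayleigh channels with ideal hardware,
maximum-ratio combining and LSFD. Arguments: covariances `R m k`, pilot assignment `π`,
correlations `ρt k` between the pilot instant of user `k` and the estimation instant and `ρn k`
between the estimation and the data instant, data powers `p`, pilot powers `pp`, noise power
`s`. -/
namespace AgingRayleigh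

variable {M K N T : ℕ} (R : Fin M → Fin K → Matrix (Fin N) (Fin N) ℂ) (π : Fin K → Fin T)
  (ρt ρn p pp : Fin K → ℝ) (s : ℝ)

/-- `(∑_{j : π_j = π_k} p̃_j R_{mj} + s I)⁻¹`. -/
def Ψ (m : Fin M) (k : Fin K) : Matrix (Fin N) (Fin N) ℂ :=
  (∑ j ∈ Finset.univ.filter (fun j => π j = π k), (pp j : ℂ) • R m j + (s : ℂ) • 1)⁻¹

/-- `Q̄_{mki} = √(p̃_k p̃_i) ρt_k ρt_i R_{mi} Ψ_{mk} R_{mk}`. -/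
def Qbar (m : Fin M) (k i : Fin K) : Matrix (Fin N) (Fin N) ℂ :=
  ((Real.sqrt (pp k * pp i) * ρt k * ρt i : ℝ) : ℂ) • (R m i * Ψ R π pp s m k * R m k)

/-- Covariance of the MMSE channel estimate. -/
def Q (m : Fin M) (k : Fin K) : Matrix (Fin N) (Fin N) ℂ :=
  ((pp k * ρt k ^ 2 : ℝ) : ℂ) • (R m k * Ψ R π pp s m k * R m k)

def sinr (a : Fin M → ℂ) (k : Fin K) : ℝ :=
  (ρn k ^ 2 * p k * ‖∑ m, star (a m) * (Q R π ρt pp s m k).trace‖ ^ 2) /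
    (∑ i, p i * ∑ m, ‖a m‖ ^ 2 * (Q R π ρt pp s m k * R m i).trace.re
      + ∑ i ∈ (Finset.univ.filter (fun i => π i = π k)).erase k,
          ρn i ^ 2 * p i * ‖∑ m, star (a m) * (Qbar R π ρt pp s m k i).trace‖ ^ 2
      + s * ∑ m, ‖a m‖ ^ 2 * (Q R π ρt pp s m k).trace.re)

end AgingRayleigh

/-! Uplink SINR of Ngo et al. for cell-free massive MIMO with single-antenna APs, block Rayleigh
fading and matched filtering. Arguments: pilot sequences `φ k` of length `τ`, large-scale fading
coefficients `β`, normalized uplink and pilot SNRs `ρu`, `ρp`, power control coefficients `η`. -/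
namespace Ngo

variable {M K τ : ℕ} (φ : Fin K → EuclideanSpace ℂ (Fin τ)) (β : Fin M → Fin K → ℝ)
  (ρu ρp : ℝ) (η : Fin K → ℝ)

/-- Mean square of the MMSE channel estimate. -/
def γ (m : Fin M) (k : Fin K) : ℝ :=
  τ * ρp * β m k ^ 2 / (τ * ρp * ∑ i, β m i * ‖inner ℂ (φ k) (φ i)‖ ^ 2 + 1)

def sinr (k : Fin K) : ℝ :=
  (ρu * η k * (∑ m, γ φ β ρp m k) ^ 2) /
    (ρu * ∑ i ∈ Finset.univ.erase k,
          η i * (∑ m, γ φ β ρp m k * (β m i / β m k)) ^ 2 * ‖inner ℂ (φ k) (φ i)‖ ^ 2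
      + ρu * ∑ i, η i * ∑ m, γ φ β ρp m k * β m i
      + ∑ m, γ φ β ρp m k)

end Ngo

end

/-!
For uncorrelated Rayleigh fading and ideal hardware every signal is a linear form in independent
`CN(0,1)` variables (small-scale fading at the instant `λ`, innovations, receiver noise): the
line-of-sight components, the distortions and the quantization noises vanish, and the pilot signal
`y` at AP `m` has covariance `D • 1` with `D = ∑_{i ∈ P_k} p̃_i β_{mi} + σ²`. The LMMSE estimate is
therefore `ĥ = c • y` with a real scalar `c` (`CFParams.lmmseGain`) such that `c² D = γ̄`.

Each term of the SINR is then a combination `∑_q w_q * conj (y_q) * v_q` over the antennas `q` of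
all APs, where `y_q` is the pilot signal and `v_q` a channel, an innovation or a noise. Its second
moment is a fourth moment of Gaussian linear forms, given by Isserlis' theorem
(`IsStdComplexGaussianFamily.integral_star_linForm_mul_mul_star`). As distinct antennas are
uncorrelated, it splits into the square of the coherent mean `∑ w_q E[conj y_q * v_q]` and the
incoherent sum `∑ |w_q|² E|y_q|² E|v_q|²` (`IsStdComplexGaussianFamily.power_bilinForm`). The
coherent part survives only in the desired signal, where AP `m` contributes `N γ̄_{mk}`, and in the
interference of the users `i` with the same pilot instant, where it contributes
`N √(γ̄_{mk} γ̄_{mi})`, both up to factors that do not depend on the AP; the sign of the correlation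
is one of them. The incoherent parts of the beamforming uncertainty and of the channel aging add
up to the interference term of the user `k` itself, because `ρ² + ρbar² = 1`.

Linear forms are represented by finitely supported coefficient vectors, on which covariances are
inner products (`coeffInner`), so that the second-order statistics of the model are finite
computations. The comparison with the closed form for correlated Rayleigh channels is a computation
with scalar matrices. For the comparison with Ngo et al., the correlation at the pilot lag is
obtained from the correlation at the data lag: `J₀ x = 1` only for `x = 0`, so that `ρ = 1` at one
nonzero lag forces a vanishing Doppler shift.
-/

/-! ### Moments of the complex Gaussian law -/

open scoped NNReal in
lemma integral_pow_four_gaussianReal (v : ℝ≥0) :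
    ∫ x, x ^ 4 ∂gaussianReal 0 v = 3 * (v : ℝ) ^ 2 := by
  have h := iteratedDeriv_mgf_zero (X := fun x : ℝ ↦ x) (μ := gaussianReal 0 v) (by simp) 4
  rw [mgf_fun_id_gaussianReal] at h
  simp only [zero_mul, zero_add] at h
  have he (t : ℝ) : HasDerivAt (fun t : ℝ ↦ Real.exp (v * t ^ 2 / 2))
      (v * t * Real.exp (v * t ^ 2 / 2)) t := by
    convert! (((hasDerivAt_id t).pow 2).const_mul ((v : ℝ) / 2)).exp using 1
    · ext s; simp; ring_nf
    · simp; ring_nf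
  have h1 : deriv (fun t : ℝ ↦ Real.exp (v * t ^ 2 / 2)) =
      fun t ↦ v * t * Real.exp (v * t ^ 2 / 2) := funext fun t ↦ (he t).deriv
  have h2 : deriv (fun t : ℝ ↦ v * t * Real.exp (v * t ^ 2 / 2)) =
      fun t ↦ (v + v ^ 2 * t ^ 2) * Real.exp (v * t ^ 2 / 2) := funext fun t ↦ by
    have := ((hasDerivAt_id t).const_mul (v : ℝ)).mul (he t)
    refine (this.congr_deriv ?_).deriv
    simp; ring
  have h3 : deriv (fun t : ℝ ↦ (v + v ^ 2 * t ^ 2) * Real.exp (v * t ^ 2 / 2)) =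
      fun t ↦ (3 * v ^ 2 * t + v ^ 3 * t ^ 3) * Real.exp (v * t ^ 2 / 2) := funext fun t ↦ by
    have := ((((hasDerivAt_id t).pow 2).const_mul ((v : ℝ) ^ 2)).const_add (v : ℝ)).mul (he t)
    refine (this.congr_deriv ?_).deriv
    simp; ring
  have h4 : deriv (fun t : ℝ ↦ (3 * v ^ 2 * t + v ^ 3 * t ^ 3) * Real.exp (v * t ^ 2 / 2)) 0 =
      3 * (v : ℝ) ^ 2 := by
    have := (((hasDerivAt_id (0 : ℝ)).const_mul (3 * (v : ℝ) ^ 2)).add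
      (((hasDerivAt_id (0 : ℝ)).pow 3).const_mul ((v : ℝ) ^ 3))).mul (he 0)
    refine (this.congr_deriv ?_).deriv
    simp
  rw [iteratedDeriv_succ, iteratedDeriv_succ, iteratedDeriv_succ, iteratedDeriv_one, h1, h2, h3,
    h4] at h
  rw [h]
  simp

lemma integral_sq_gaussianReal (v : NNReal) : ∫ x, x ^ 2 ∂gaussianReal 0 v = v := by
  have h := variance_fun_id_gaussianReal (μ := 0) (v := v)
  rw [variance_eq_integral (by fun_prop)] at h
  simpa using h

namespace stdComplexGaussian

lemma measurable_mk : Measurable (fun x : ℝ × ℝ ↦ (⟨x.1, x.2⟩ : ℂ)) := by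
  exact Complex.measurableEquivRealProd.symm.measurable

instance : IsProbabilityMeasure stdComplexGaussian :=
  Measure.isProbabilityMeasure_map measurable_mk.aemeasurable

lemma integral_eq {f : ℂ → ℂ} (hf : Continuous f) :
    ∫ z, f z ∂stdComplexGaussian =
      ∫ x, f ⟨x.1, x.2⟩ ∂((gaussianReal 0 (1 / 2)).prod (gaussianReal 0 (1 / 2))) := by
  rw [stdComplexGaussian, integral_map measurable_mk.aemeasurable hf.aestronglyMeasurable]

/-- Rotation by a right angle preserves the circularly symmetric Gaussian law. -/
lemma map_I_mul : stdComplexGaussian.map (fun z ↦ Complex.I * z) = stdComplexGaussian := by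
  have h1 : (fun z ↦ Complex.I * z) ∘ (fun x : ℝ × ℝ ↦ (⟨x.1, x.2⟩ : ℂ)) =
      (fun x : ℝ × ℝ ↦ (⟨x.1, x.2⟩ : ℂ)) ∘ (Prod.map (fun x ↦ -x) id) ∘ Prod.swap := by
    ext x
    apply Complex.ext <;> simp
  rw [stdComplexGaussian, Measure.map_map (by fun_prop) measurable_mk, h1,
    ← Measure.map_map measurable_mk (by fun_prop), ← Measure.map_map (by fun_prop) (by fun_prop),
    Measure.prod_swap, ← Measure.map_prod_map _ _ (by fun_prop) (by fun_prop),
    gaussianReal_map_neg]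
  simp

lemma memLp_id (q : ENNReal) (hq : q ≠ ⊤) : MemLp (fun z ↦ z) q stdComplexGaussian := by
  rw [stdComplexGaussian, memLp_map_measure_iff (by fun_prop) measurable_mk.aemeasurable]
  have h := memLp_id_gaussianReal' (μ := 0) (v := 1 / 2) q hq
  have h1 : MemLp (fun x : ℝ × ℝ ↦ x.1) q
      ((gaussianReal 0 (1 / 2)).prod (gaussianReal 0 (1 / 2))) := h.comp_fst _
  have h2 : MemLp (fun x : ℝ × ℝ ↦ x.2) q
      ((gaussianReal 0 (1 / 2)).prod (gaussianReal 0 (1 / 2))) := h.comp_snd _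
  have h3 := h1.ofReal (K := ℂ) |>.add (h2.ofReal (K := ℂ) |>.mul_const Complex.I)
  refine h3.congr_norm (by exact measurable_mk.aestronglyMeasurable) (ae_of_all _ fun x ↦ ?_)
  simp only [Pi.add_apply, Function.comp]
  congr 1
  exact (Complex.mk_eq_add_mul_I _ _).symm

lemma integral_norm_sq : ∫ z, ((‖z‖ ^ 2 : ℝ) : ℂ) ∂stdComplexGaussian = 1 := by
  rw [integral_eq (by fun_prop), integral_complex_ofReal]
  have h := (memLp_id_gaussianReal' (μ := 0) (v := 1 / 2) 2 (by simp)).integrable_sq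
  simp only [id] at h
  have h0 := h
  simp_rw [Complex.sq_norm, Complex.normSq_mk, ← sq]
  rw [integral_add (h.comp_fst _) (h0.comp_snd _), integral_fun_fst (fun x ↦ x ^ 2),
    integral_fun_snd (fun x ↦ x ^ 2), integral_sq_gaussianReal]
  norm_num

lemma integral_norm_pow_four : ∫ z, ((‖z‖ ^ 4 : ℝ) : ℂ) ∂stdComplexGaussian = 2 := by
  rw [integral_eq (by fun_prop), integral_complex_ofReal]
  have h := (memLp_id_gaussianReal' (μ := 0) (v := 1 / 2) 2 (by simp)).integrable_sq
  have h4 := (memLp_id_gaussianReal' (μ := 0) (v := 1 / 2) 4 (by simp)).integrable_norm_pow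
    (by simp)
  simp only [id, Real.norm_eq_abs] at h h4
  have h4' : Integrable (fun x : ℝ ↦ x ^ 4) (gaussianReal 0 (1 / 2)) := by
    simpa [Even.pow_abs (n := 4) (by decide)] using h4
  have h5 := h4'
  have e (x : ℝ × ℝ) : ‖(⟨x.1, x.2⟩ : ℂ)‖ ^ 4 = x.1 ^ 4 + 2 * (x.1 ^ 2 * x.2 ^ 2) + x.2 ^ 4 := by
    rw [show ‖(⟨x.1, x.2⟩ : ℂ)‖ ^ 4 = (‖(⟨x.1, x.2⟩ : ℂ)‖ ^ 2) ^ 2 by ring, Complex.sq_norm,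
      Complex.normSq_mk]
    ring
  simp_rw [e]
  have hm := (h.mul_prod h).const_mul 2
  have h14 := h4'.comp_fst (gaussianReal 0 (1 / 2))
  have hs : Integrable (fun x : ℝ × ℝ ↦ x.1 ^ 4 + 2 * (x.1 ^ 2 * x.2 ^ 2))
      ((gaussianReal 0 (1 / 2)).prod (gaussianReal 0 (1 / 2))) := h14.add hm
  rw [integral_add hs (h5.comp_snd _), integral_add h14 hm,
    integral_fun_fst (fun x ↦ x ^ 4),
    integral_fun_snd (fun x ↦ x ^ 4), integral_const_mul, integral_prod_mul (fun x ↦ x ^ 2)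
    (fun x ↦ x ^ 2), integral_sq_gaussianReal, integral_pow_four_gaussianReal]
  norm_num

/-- Mixed moments up to degree two in `z` and in its conjugate. The unbalanced ones vanish because
a rotation by a right angle multiplies them by a nontrivial power of `I`. -/
lemma integral_star_pow_mul_pow {i j : ℕ} (hi : i ≤ 2) (hj : j ≤ 2) :
    ∫ z, star z ^ i * z ^ j ∂stdComplexGaussian = if i = j then (i.factorial : ℂ) else 0 := by
  have hcont : Continuous fun z : ℂ ↦ star z ^ i * z ^ j := by fun_prop
  have hrot : ∫ z, star z ^ i * z ^ j ∂stdComplexGaussian =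
      (star Complex.I ^ i * Complex.I ^ j) * ∫ z, star z ^ i * z ^ j ∂stdComplexGaussian := by
    conv_lhs => rw [← map_I_mul]
    rw [integral_map (by fun_prop) hcont.aestronglyMeasurable, ← integral_const_mul]
    congr 1
    ext z
    simp only [star_mul', mul_pow]
    ring
  have hns (z : ℂ) : star z * z = ((‖z‖ ^ 2 : ℝ) : ℂ) := by
    simpa using Complex.conj_mul' z
  have hone : (∫ z, star z ^ i * z ^ j ∂stdComplexGaussian = 0) ∨
      star Complex.I ^ i * Complex.I ^ j = 1 := by
    by_contra! hne
    refine hne.2 (mul_right_cancel₀ hne.1 ?_)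
    rw [one_mul]; exact hrot.symm
  split_ifs with h
  · subst h
    interval_cases i
    · simp
    · simp only [pow_one, hns]
      simpa using integral_norm_sq
    · have h4 (z : ℂ) : star z ^ 2 * z ^ 2 = ((‖z‖ ^ 4 : ℝ) : ℂ) := by
        rw [← mul_pow, hns]
        push_cast; ring
      simp only [h4]
      rw [integral_norm_pow_four]
      simp
  · refine hone.resolve_right fun h1 ↦ ?_
    have hre := congrArg Complex.re h1
    clear hrot hone hcont
    interval_cases i <;> interval_cases j <;> simp [pow_succ] at h hre
    all_goals norm_num at hre

end stdComplexGaussian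

/-! ### Linear forms in independent complex Gaussian variables -/

/-- A family of independent `CN(0,1)` random variables. -/
structure IsStdComplexGaussianFamily {ι Ω : Type*} [MeasurableSpace Ω] (P : Measure Ω)
    (Z : ι → Ω → ℂ) : Prop where
  measurable : ∀ s, Measurable (Z s)
  indep : iIndepFun Z P
  law : ∀ s, P.map (Z s) = stdComplexGaussian

/-- The linear form `∑ s, x s * Z s` in a family of random variables. -/
noncomputable def linForm {ι Ω : Type*} (Z : ι → Ω → ℂ) (x : ι →₀ ℂ) (ω : Ω) : ℂ :=
  Finsupp.linearCombination ℂ (fun s ↦ Z s ω) x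

/-- The inner product `∑ s, conj (x s) * y s` of coefficient vectors: the covariance
`E[conj (linForm x) * linForm y]` of the linear forms in a standard Gaussian family. -/
noncomputable def coeffInner {ι : Type*} (x y : ι →₀ ℂ) : ℂ :=
  Finsupp.linearCombination ℂ (fun s ↦ star (x s)) y

section LinForm

variable {ι Ω : Type*} (Z : ι → Ω → ℂ) (ω : Ω)

@[simp] lemma linForm_zero : linForm Z 0 ω = 0 := by simp [linForm]

@[simp] lemma linForm_add (x y : ι →₀ ℂ) :
    linForm Z (x + y) ω = linForm Z x ω + linForm Z y ω := by simp [linForm]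

@[simp] lemma linForm_smul (c : ℂ) (x : ι →₀ ℂ) :
    linForm Z (c • x) ω = c * linForm Z x ω := by simp [linForm]

@[simp] lemma linForm_sum {κ : Type*} (S : Finset κ) (x : κ → ι →₀ ℂ) :
    linForm Z (∑ i ∈ S, x i) ω = ∑ i ∈ S, linForm Z (x i) ω := by simp [linForm]

@[simp] lemma linForm_single (s : ι) (c : ℂ) :
    linForm Z (Finsupp.single s c) ω = c * Z s ω := by simp [linForm]

end LinForm

section CoeffInner

variable {ι : Type*} (x x' y y' : ι →₀ ℂ)

@[simp] lemma coeffInner_zero_left : coeffInner 0 y = 0 := by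
  simp [coeffInner, Finsupp.linearCombination_apply]

@[simp] lemma coeffInner_zero_right : coeffInner x 0 = 0 := by simp [coeffInner]

@[simp] lemma coeffInner_add_right :
    coeffInner x (y + y') = coeffInner x y + coeffInner x y' := by simp [coeffInner]

@[simp] lemma coeffInner_add_left :
    coeffInner (x + x') y = coeffInner x y + coeffInner x' y := by
  simp only [coeffInner, Finsupp.linearCombination_apply, Finsupp.sum, ← Finset.sum_add_distrib]
  refine Finset.sum_congr rfl fun s _ ↦ ?_
  simp [mul_add]

@[simp] lemma coeffInner_smul_right (c : ℂ) :
    coeffInner x (c • y) = c * coeffInner x y := by simp [coeffInner]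

@[simp] lemma coeffInner_smul_left (c : ℂ) :
    coeffInner (c • x) y = star c * coeffInner x y := by
  simp only [coeffInner, Finsupp.linearCombination_apply, Finsupp.sum, Finset.mul_sum]
  refine Finset.sum_congr rfl fun s _ ↦ ?_
  simp; ring

@[simp] lemma coeffInner_sum_right {κ : Type*} (S : Finset κ) (z : κ → ι →₀ ℂ) :
    coeffInner x (∑ i ∈ S, z i) = ∑ i ∈ S, coeffInner x (z i) := by simp [coeffInner]

@[simp] lemma coeffInner_sum_left {κ : Type*} (S : Finset κ) (z : κ → ι →₀ ℂ) :
    coeffInner (∑ i ∈ S, z i) y = ∑ i ∈ S, coeffInner (z i) y := by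
  classical
  induction S using Finset.induction_on with
  | empty => simp
  | insert a S ha ih => simp [Finset.sum_insert ha, ih]

lemma coeffInner_single_single [DecidableEq ι] (s t : ι) (c d : ℂ) :
    coeffInner (Finsupp.single s c) (Finsupp.single t d) = if s = t then star c * d else 0 := by
  by_cases h : s = t
  · subst h; simp [coeffInner, mul_comm]
  · simp [coeffInner, Finsupp.single_apply, h]

lemma star_coeffInner : star (coeffInner x y) = coeffInner y x := by
  classical
  induction x using Finsupp.induction_linear with
  | zero => simp
  | add x x' h h' => simp [← h, ← h']
  | single s c =>
    induction y using Finsupp.induction_linear with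
    | zero => simp
    | add x x' h h' => simp [← h, ← h']
    | single t d =>
      simp only [coeffInner_single_single, eq_comm (a := t)]
      split_ifs <;> simp [mul_comm]

end CoeffInner

namespace IsStdComplexGaussianFamily

variable {ι Ω : Type*} [MeasurableSpace Ω] {P : Measure Ω} {Z : ι → Ω → ℂ}

lemma memLp_linForm (hZ : IsStdComplexGaussianFamily P Z) (x : ι →₀ ℂ) (q : ENNReal)
    (hq : q ≠ ⊤) : MemLp (linForm Z x) q P := by
  induction x using Finsupp.induction_linear with
  | zero =>
    have : linForm Z 0 = fun _ ↦ 0 := by funext ω; simp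
    rw [this]
    exact MemLp.zero'
  | add x y hx hy =>
    have hs : linForm Z (x + y) = linForm Z x + linForm Z y := by funext ω; simp
    rw [hs]
    exact hx.add hy
  | single s c =>
    have h : MemLp (Z s) q P := by
      have := stdComplexGaussian.memLp_id q hq
      rw [← hZ.law s, memLp_map_measure_iff (by fun_prop) (hZ.measurable s).aemeasurable] at this
      exact this
    have hs : linForm Z (Finsupp.single s c) = fun ω ↦ c * Z s ω := by funext ω; simp
    rw [hs]
    exact h.const_mul c

/-- Mixed moments of the family, up to degree two in each variable and in its conjugate. -/
lemma integral_prod_star_pow_mul_pow (hZ : IsStdComplexGaussianFamily P Z) (S : Finset ι)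
    (a b : ι → ℕ) (ha : ∀ s, a s ≤ 2) (hb : ∀ s, b s ≤ 2) :
    ∫ ω, ∏ s ∈ S, (star (Z s ω) ^ a s * Z s ω ^ b s) ∂P =
      ∏ s ∈ S, if a s = b s then ((a s).factorial : ℂ) else 0 := by
  have h := iIndepFun.integral_fun_prod_comp (X := fun s : S ↦ Z s)
    (hZ.indep.precomp (g := ((↑) : S → ι)) Subtype.val_injective)
    (f := fun s z ↦ star z ^ a s * z ^ b s) (fun s ↦ (hZ.measurable s).aemeasurable)
    (fun s ↦ (by fun_prop : Continuous fun z : ℂ ↦ star z ^ a s * z ^ b s).aestronglyMeasurable)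
  rw [← Finset.prod_coe_sort]
  simp_rw [← Finset.prod_coe_sort S]
  rw [h]
  refine Finset.prod_congr rfl fun s _ ↦ ?_
  rw [← stdComplexGaussian.integral_star_pow_mul_pow (ha s) (hb s), ← hZ.law s,
    integral_map (hZ.measurable s).aemeasurable
      (by fun_prop : Continuous fun z : ℂ ↦ star z ^ a s * z ^ b s).aestronglyMeasurable]

lemma integral_star_mul (hZ : IsStdComplexGaussianFamily P Z) [DecidableEq ι] (i j : ι) :
    ∫ ω, star (Z i ω) * Z j ω ∂P = if i = j then 1 else 0 := by
  have h := hZ.integral_prod_star_pow_mul_pow {i, j} (fun s ↦ if i = s then 1 else 0)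
    (fun s ↦ if j = s then 1 else 0) (fun s ↦ by split_ifs <;> simp)
    (fun s ↦ by split_ifs <;> simp)
  simp only [Finset.prod_mul_distrib, Finset.prod_pow_boole] at h
  simp only [Finset.mem_insert, Finset.mem_singleton, true_or, or_true, if_true] at h
  rw [h]
  by_cases hij : i = j
  · subst hij; simp
  · simp [Finset.prod_insert, hij, Ne.symm hij]

/-- Isserlis' theorem for four members of the family. -/
lemma integral_star_mul_mul_star (hZ : IsStdComplexGaussianFamily P Z) [DecidableEq ι]
    (i j k l : ι) :
    ∫ ω, star (Z i ω) * Z j ω * (Z k ω * star (Z l ω)) ∂P =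
      (if i = j then 1 else 0) * (if l = k then 1 else 0)
        + (if i = k then 1 else 0) * (if l = j then 1 else 0) := by
  have h := hZ.integral_prod_star_pow_mul_pow {i, j, k, l}
    (fun s ↦ (if i = s then 1 else 0) + (if l = s then 1 else 0))
    (fun s ↦ (if j = s then 1 else 0) + (if k = s then 1 else 0))
    (fun s ↦ by split_ifs <;> simp) (fun s ↦ by split_ifs <;> simp)
  simp only [Finset.prod_mul_distrib, pow_add, Finset.prod_pow_boole] at h
  simp only [Finset.mem_insert, Finset.mem_singleton, true_or, or_true, if_true] at h
  rw [show (fun ω ↦ star (Z i ω) * Z j ω * (Z k ω * star (Z l ω))) =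
    fun ω ↦ star (Z i ω) * star (Z l ω) * (Z j ω * Z k ω) by ext; ring, h]
  rcases eq_or_ne i l with rfl | hil
  · by_cases hj : i = j
    · subst hj
      by_cases hk : i = k
      · subst hk; simp; norm_num
      · rw [Finset.prod_eq_zero (i := i) (by simp) (by simp [Ne.symm hk])]
        simp [hk]
    · rw [Finset.prod_eq_zero (i := i) (by simp) ?_]
      · simp [hj]
      · by_cases hk : k = i <;> simp [Ne.symm hj, hk]
  · by_cases hj : i = j
    · subst hj
      by_cases hk : l = k
      · subst hk
        simp [Finset.prod_insert, hil, Ne.symm hil]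
      · rw [Finset.prod_eq_zero (i := l) (by simp) (by simp [Ne.symm hk, hil])]
        simp [hk, Ne.symm hil]
    · by_cases hk : i = k
      · subst hk
        by_cases hl : l = j
        · subst hl
          simp [Finset.prod_insert, hil, Ne.symm hil]
        · rw [Finset.prod_eq_zero (i := l) (by simp) (by simp [Ne.symm hl, hil])]
          simp [hl, hj]
      · rw [Finset.prod_eq_zero (i := i) (by simp)
          (by simp [Ne.symm hj, Ne.symm hk, Ne.symm hil])]
        simp [hj, hk]

/-- The covariance of two linear forms is the inner product of their coefficient vectors. -/
lemma integral_star_linForm_mul (hZ : IsStdComplexGaussianFamily P Z) (x y : ι →₀ ℂ) :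
    ∫ ω, star (linForm Z x ω) * linForm Z y ω ∂P = coeffInner x y := by
  classical
  have hint (u v : ι →₀ ℂ) : Integrable (fun ω ↦ star (linForm Z u ω) * linForm Z v ω) P :=
    (hZ.memLp_linForm u 2 (by simp)).star.integrable_mul (hZ.memLp_linForm v 2 (by simp))
  induction x using Finsupp.induction_linear with
  | zero => simp
  | add x x' hx hx' =>
    simp only [linForm_add, star_add, add_mul, coeffInner_add_left]
    rw [integral_add (hint _ _) (hint _ _), hx, hx']
  | single i c =>
    induction y using Finsupp.induction_linear with
    | zero => simp
    | add y y' hy hy' =>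
      simp only [linForm_add, mul_add, coeffInner_add_right]
      rw [integral_add (hint _ _) (hint _ _), hy, hy']
    | single j d =>
      simp only [linForm_single, coeffInner_single_single]
      rw [show (fun ω ↦ star (c * Z i ω) * (d * Z j ω)) =
        fun ω ↦ (star c * d) * (star (Z i ω) * Z j ω) by ext; simp; ring, integral_const_mul,
        hZ.integral_star_mul]
      simp

lemma memLp_star_linForm_mul (hZ : IsStdComplexGaussianFamily P Z) (x y : ι →₀ ℂ) :
    MemLp (fun ω ↦ star (linForm Z x ω) * linForm Z y ω) 2 P := by
  have : ENNReal.HolderTriple 4 4 2 := ⟨by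
    rw [← ENNReal.toReal_eq_toReal_iff' (by simp) (by simp)]
    rw [ENNReal.toReal_add (by simp) (by simp)]; norm_num⟩
  exact (hZ.memLp_linForm y 4 (by simp)).mul (hZ.memLp_linForm x 4 (by simp)).star

/-- Isserlis' theorem for circularly symmetric Gaussian linear forms. -/
lemma integral_star_linForm_mul_mul_star (hZ : IsStdComplexGaussianFamily P Z) (x y u v : ι →₀ ℂ) :
    ∫ ω, star (linForm Z x ω) * linForm Z y ω * (linForm Z u ω * star (linForm Z v ω)) ∂P =
      coeffInner x y * coeffInner v u + coeffInner x u * coeffInner v y := by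
  classical
  have hint (x y u v : ι →₀ ℂ) : Integrable (fun ω ↦ star (linForm Z x ω) * linForm Z y ω *
      (linForm Z u ω * star (linForm Z v ω))) P := by
    have h := (hZ.memLp_star_linForm_mul v u)
    exact (hZ.memLp_star_linForm_mul x y).integrable_mul (by simpa only [mul_comm] using h)
  induction x using Finsupp.induction_linear with
  | zero => simp
  | add x x' hx hx' =>
    simp only [linForm_add, star_add, add_mul, coeffInner_add_left]
    rw [integral_add (hint _ _ _ _) (hint _ _ _ _), hx, hx']
    ring
  | single i c =>
  induction y using Finsupp.induction_linear with
  | zero => simp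
  | add y y' hy hy' =>
    simp only [linForm_add, mul_add, add_mul, coeffInner_add_right]
    rw [integral_add (hint _ _ _ _) (hint _ _ _ _), hy, hy']
    ring
  | single j d =>
  induction u using Finsupp.induction_linear with
  | zero => simp
  | add u u' hu hu' =>
    simp only [linForm_add, mul_add, add_mul, coeffInner_add_right]
    rw [integral_add (hint _ _ _ _) (hint _ _ _ _), hu, hu']
    ring
  | single k e =>
  induction v using Finsupp.induction_linear with
  | zero => simp
  | add v v' hv hv' =>
    simp only [linForm_add, star_add, mul_add, coeffInner_add_left]
    rw [integral_add (hint _ _ _ _) (hint _ _ _ _), hv, hv']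
    ring
  | single l f =>
    simp only [linForm_single, coeffInner_single_single]
    rw [show (fun ω ↦ star (c * Z i ω) * (d * Z j ω) * (e * Z k ω * star (f * Z l ω))) =
      fun ω ↦ (star c * d * e * star f) * (star (Z i ω) * Z j ω * (Z k ω * star (Z l ω))) by
        ext; simp; ring, integral_const_mul, hZ.integral_star_mul_mul_star]
    split_ifs <;> simp <;> ring

end IsStdComplexGaussianFamily

/-! ### Bilinear forms in Gaussian variables -/

/-- The mean power of a centered variable is its mean power minus the squared mean. -/
lemma CFParams.power_sub_integral {Ω : Type*} [MeasurableSpace Ω] (P : Measure Ω)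
    [IsProbabilityMeasure P] {Y : Ω → ℂ} (hY : MemLp Y 2 P) :
    CFParams.power P (fun ω ↦ Y ω - ∫ ω', Y ω' ∂P) =
      CFParams.power P Y - ‖∫ ω, Y ω ∂P‖ ^ 2 := by
  set c := ∫ ω', Y ω' ∂P with hc
  have hi : Integrable Y P := hY.integrable (by simp)
  have hsq : Integrable (fun ω ↦ ‖Y ω‖ ^ 2) P := hY.integrable_norm_pow (by simp)
  have hcr : Integrable (fun ω ↦ (star c * Y ω).re) P := (hi.const_mul (star c)).re
  have e (ω : Ω) : ‖Y ω - c‖ ^ 2 = ‖Y ω‖ ^ 2 - 2 * (star c * Y ω).re + ‖c‖ ^ 2 := by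
    simp only [Complex.sq_norm, Complex.normSq_apply]
    simp; ring
  have hre : ∫ ω, (star c * Y ω).re ∂P = ‖c‖ ^ 2 := by
    have h : ∫ ω, (star c * Y ω).re ∂P = (∫ ω, star c * Y ω ∂P).re :=
      integral_re (hi.const_mul (star c))
    rw [h, integral_const_mul, ← hc]
    have : star c * c = ((‖c‖ ^ 2 : ℝ) : ℂ) := by simpa using Complex.conj_mul' c
    rw [this, Complex.ofReal_re]
  have hsub : Integrable (fun ω ↦ ‖Y ω‖ ^ 2 - 2 * (star c * Y ω).re) P :=
    hsq.sub (hcr.const_mul 2)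
  simp only [CFParams.power, e]
  rw [integral_add hsub (integrable_const _), integral_sub hsq (hcr.const_mul 2),
    integral_const_mul, hre]
  simp; ring

lemma CFParams.power_const_mul {Ω : Type*} [MeasurableSpace Ω] (P : Measure Ω) (c : ℂ)
    (Y : Ω → ℂ) : CFParams.power P (fun ω ↦ c * Y ω) = ‖c‖ ^ 2 * CFParams.power P Y := by
  simp only [CFParams.power, norm_mul, mul_pow, integral_const_mul]

/-- A combination of products `conj (y p) * v p` of linear forms. -/
noncomputable def bilinForm {ι κ Ω : Type*} [Fintype κ] (Z : ι → Ω → ℂ) (w : κ → ℂ)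
    (y v : κ → ι →₀ ℂ) (ω : Ω) : ℂ :=
  ∑ p, w p * (star (linForm Z (y p) ω) * linForm Z (v p) ω)

namespace IsStdComplexGaussianFamily

variable {ι κ Ω : Type*} [Fintype κ] [MeasurableSpace Ω] {P : Measure Ω} {Z : ι → Ω → ℂ}

lemma memLp_bilinForm (hZ : IsStdComplexGaussianFamily P Z) (w : κ → ℂ) (y v : κ → ι →₀ ℂ) :
    MemLp (bilinForm Z w y v) 2 P :=
  memLp_finsetSum _ fun p _ ↦ (hZ.memLp_star_linForm_mul (y p) (v p)).const_mul (w p)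

lemma integral_bilinForm [IsProbabilityMeasure P] (hZ : IsStdComplexGaussianFamily P Z)
    (w : κ → ℂ) (y v : κ → ι →₀ ℂ) :
    ∫ ω, bilinForm Z w y v ω ∂P = ∑ p, w p * coeffInner (y p) (v p) := by
  simp only [bilinForm]
  rw [integral_finsetSum _ fun p _ ↦
    ((hZ.memLp_star_linForm_mul (y p) (v p)).integrable (by simp)).const_mul (w p)]
  simp only [integral_const_mul, hZ.integral_star_linForm_mul]

/-- Mean power of a combination of products of linear forms. When distinct indices are
uncorrelated, the covariances `C` add up coherently, the variances `D` and `V` incoherently. -/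
lemma power_bilinForm [IsProbabilityMeasure P] [DecidableEq κ]
    (hZ : IsStdComplexGaussianFamily P Z)
    (w : κ → ℂ) (y v : κ → ι →₀ ℂ) (D V : κ → ℝ) (C : κ → ℂ)
    (hD : ∀ p q, coeffInner (y p) (y q) = if p = q then (D p : ℂ) else 0)
    (hV : ∀ p q, coeffInner (v p) (v q) = if p = q then (V p : ℂ) else 0)
    (hC : ∀ p, coeffInner (y p) (v p) = C p) :
    CFParams.power P (bilinForm Z w y v) =
      ‖∑ p, w p * C p‖ ^ 2 + ∑ p, ‖w p‖ ^ 2 * (D p * V p) := by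
  have hsq (z : ℂ) : ((‖z‖ ^ 2 : ℝ) : ℂ) = z * star z := by
    simpa using (Complex.mul_conj' z).symm
  have hint (p q : κ) : Integrable (fun ω ↦ star (linForm Z (y p) ω) * linForm Z (v p) ω *
      (linForm Z (y q) ω * star (linForm Z (v q) ω))) P := by
    have h := (hZ.memLp_star_linForm_mul (v q) (y q))
    exact (hZ.memLp_star_linForm_mul (y p) (v p)).integrable_mul (by simpa only [mul_comm] using h)
  rw [← Complex.ofReal_inj, CFParams.power, ← integral_complex_ofReal]
  have e (ω : Ω) : ((‖bilinForm Z w y v ω‖ ^ 2 : ℝ) : ℂ) = ∑ p, ∑ q, (w p * star (w q)) *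
      (star (linForm Z (y p) ω) * linForm Z (v p) ω *
        (linForm Z (y q) ω * star (linForm Z (v q) ω))) := by
    rw [hsq, bilinForm, star_sum, Finset.sum_mul_sum]
    refine Finset.sum_congr rfl fun p _ ↦ Finset.sum_congr rfl fun q _ ↦ ?_
    simp only [star_mul', star_star]
    ring
  simp_rw [e]
  rw [integral_finsetSum _ fun p _ ↦ integrable_finsetSum _ fun q _ ↦ (hint p q).const_mul _]
  have hC' (q : κ) : coeffInner (v q) (y q) = star (C q) := by rw [← hC, star_coeffInner]
  have h1 (p : κ) : ∫ ω, ∑ q, (w p * star (w q)) *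
      (star (linForm Z (y p) ω) * linForm Z (v p) ω *
        (linForm Z (y q) ω * star (linForm Z (v q) ω))) ∂P =
      ∑ q, (w p * C p) * star (w q * C q) + ((‖w p‖ ^ 2 * (D p * V p) : ℝ) : ℂ) := by
    rw [integral_finsetSum _ fun q _ ↦ (hint p q).const_mul _]
    simp only [integral_const_mul, hZ.integral_star_linForm_mul_mul_star, hC, hC', hD, hV, mul_add,
      Finset.sum_add_distrib]
    congr 1
    · refine Finset.sum_congr rfl fun q _ ↦ ?_
      rw [star_mul']; ring
    · simp only [eq_comm (b := p), ite_mul, mul_ite, zero_mul, mul_zero]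
      rw [Complex.ofReal_mul, hsq, Complex.ofReal_mul]
      simp
  simp only [h1, Finset.sum_add_distrib, Complex.ofReal_add, hsq, star_sum,
    Finset.sum_mul_sum, Complex.ofReal_sum]

end IsStdComplexGaussianFamily

/-! ### Bessel function and temporal correlation -/

lemma continuous_cos_mul_sin (x : ℝ) : Continuous fun θ ↦ Real.cos (x * Real.sin θ) := by
  fun_prop

lemma besselJ0_zero : besselJ0 0 = 1 := by
  simp [besselJ0, Real.pi_ne_zero]

lemma besselJ0_neg (x : ℝ) : besselJ0 (-x) = besselJ0 x := by
  simp [besselJ0, neg_mul, Real.cos_neg]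

lemma abs_besselJ0_le_one (x : ℝ) : |besselJ0 x| ≤ 1 := by
  have h := intervalIntegral.norm_integral_le_of_norm_le_const (a := 0) (b := Real.pi) (C := 1)
    (f := fun θ ↦ Real.cos (x * Real.sin θ)) fun θ _ ↦ Real.abs_cos_le_one _
  rw [sub_zero, one_mul, abs_of_pos Real.pi_pos, Real.norm_eq_abs] at h
  rw [besselJ0, abs_mul, abs_of_pos (inv_pos.2 Real.pi_pos)]
  calc Real.pi⁻¹ * _ ≤ Real.pi⁻¹ * Real.pi := by gcongr
    _ = 1 := inv_mul_cancel₀ Real.pi_ne_zero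

/-- The Bessel function `J₀` takes the value `1` at the origin only. -/
lemma eq_zero_of_besselJ0_eq_one {x : ℝ} (h : besselJ0 x = 1) : x = 0 := by
  by_contra hx
  have hi := (continuous_cos_mul_sin x).intervalIntegrable (μ := volume) 0 Real.pi
  have hzero : ∫ θ in (0 : ℝ)..Real.pi, (1 - Real.cos (x * Real.sin θ)) = 0 := by
    rw [intervalIntegral.integral_sub (by simp) hi]
    rw [besselJ0, inv_mul_eq_one₀ Real.pi_ne_zero] at h
    rw [← h]; simp
  have hpos : 0 < 1 + |x| := by positivity
  -- an angle at which `0 < |x * sin θ| < 1`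
  have hs1 : 1 / (1 + |x|) ≤ 1 := by rw [div_le_one hpos]; linarith [abs_nonneg x]
  have hs0 : 0 < 1 / (1 + |x|) := by positivity
  have hlt : 0 < ∫ θ in (0 : ℝ)..Real.pi, (1 - Real.cos (x * Real.sin θ)) := by
    refine intervalIntegral.integral_pos Real.pi_pos
      (continuous_const.sub (continuous_cos_mul_sin x)).continuousOn
      (fun θ _ ↦ sub_nonneg.2 (Real.cos_le_one _))
      ⟨Real.arcsin (1 / (1 + |x|)), ⟨Real.arcsin_nonneg.2 hs0.le,
        (Real.arcsin_le_pi_div_two _).trans (by linarith [Real.pi_pos])⟩, ?_⟩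
    rw [Real.sin_arcsin (by linarith) hs1, sub_pos]
    refine lt_of_le_of_ne (Real.cos_le_one _) fun hc ↦ ?_
    have habs : |x * (1 / (1 + |x|))| < 1 := by
      rw [abs_mul, abs_of_pos hs0, mul_one_div, div_lt_one hpos]; linarith
    rw [abs_lt] at habs
    have hpi := Real.pi_gt_three
    have := (Real.cos_eq_one_iff_of_lt_of_lt (by linarith) (by linarith)).1 hc
    exact (mul_ne_zero hx hs0.ne') this
  exact hlt.ne' hzero

namespace CFParams

variable {M K N : ℕ} (par : CFParams M K N)

lemma ρ_neg (k : Fin K) (d : ℤ) : par.ρ k (-d) = par.ρ k d := by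
  rw [ρ, ρ, ← besselJ0_neg]
  congr 1
  push_cast; ring

lemma ρ_sub_comm (k : Fin K) (d e : ℤ) : par.ρ k (d - e) = par.ρ k (e - d) := by
  rw [← ρ_neg, neg_sub]

lemma ρ_sq_add_ρbar_sq (k : Fin K) (d : ℤ) : par.ρ k d ^ 2 + par.ρbar k d ^ 2 = 1 := by
  rw [ρbar, Real.sq_sqrt]
  · ring
  · rw [sub_nonneg, sq_le_one_iff_abs_le_one]
    exact abs_besselJ0_le_one _

/-- Full correlation at one nonzero lag means a vanishing Doppler shift. -/
lemma ρ_eq_one_of_ne_zero {k : Fin K} {d : ℤ} (hd : d ≠ 0) (h : par.ρ k d = 1) (e : ℤ) :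
    par.ρ k e = 1 := by
  have h0 := eq_zero_of_besselJ0_eq_one h
  have hd' : (d : ℝ) ≠ 0 := by exact_mod_cast hd
  rw [ρ, (mul_eq_zero.1 h0).resolve_right hd', zero_mul, besselJ0_zero]

end CFParams

/-! ### The Rayleigh model with ideal hardware -/

/-- Index set of the Gaussian primitive variables that survive under uncorrelated Rayleigh fading
and ideal hardware. -/
inductive RayleighSrc (M K N : ℕ) : Type
  /-- small-scale fading at the instant `λ` -/
  | fading (m : Fin M) (k : Fin K) (b : Fin N)
  /-- innovation at an instant -/
  | innov (m : Fin M) (k : Fin K) (n : ℕ) (b : Fin N)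
  /-- receiver noise -/
  | awgn (m : Fin M) (n : ℕ) (b : Fin N)
  deriving DecidableEq

namespace RayleighSrc

variable {M K N : ℕ}

/-- The corresponding primitive variable of the general model. -/
def toSrc : RayleighSrc M K N → Src M K N
  | fading m k b => .nlos m k b
  | innov m k n b => .innov m k n b
  | awgn m n b => .awgn m n b

lemma toSrc_injective : Function.Injective (toSrc : RayleighSrc M K N → Src M K N) := by
  intro s t h
  cases s <;> cases t <;> simp_all [toSrc]

end RayleighSrc

lemma IsSourceFamily.isStdComplexGaussianFamily {M K N : ℕ} {Ω : Type*} [MeasurableSpace Ω]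
    {P : Measure Ω} {X : Src M K N → Ω → ℂ} (hX : IsSourceFamily P X) :
    IsStdComplexGaussianFamily P (fun s : RayleighSrc M K N ↦ X s.toSrc) where
  measurable s := hX.measurable _
  indep := hX.indep.precomp RayleighSrc.toSrc_injective
  law s := by
    cases s
    · exact hX.nlos _ _ _
    · exact hX.innov _ _ _ _
    · exact hX.awgn _ _ _

namespace CFParams

open RayleighSrc

variable {M K N : ℕ} (par : CFParams M K N)

/-- Coefficients of antenna `b` of the channel at the instant `λ`. -/
noncomputable def lamCoeff (m : Fin M) (k : Fin K) (b : Fin N) : RayleighSrc M K N →₀ ℂ :=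
  Finsupp.single (fading m k b) (Real.sqrt (par.β m k) : ℂ)

/-- Coefficients of antenna `b` of the innovation at the instant `n`. -/
noncomputable def innovCoeff (m : Fin M) (k : Fin K) (n : ℕ) (b : Fin N) : RayleighSrc M K N →₀ ℂ :=
  Finsupp.single (innov m k n b) (Real.sqrt (par.β m k) : ℂ)

/-- Coefficients of antenna `b` of the receiver noise at the instant `n`. -/
noncomputable def noiseCoeff (m : Fin M) (n : ℕ) (b : Fin N) : RayleighSrc M K N →₀ ℂ :=
  Finsupp.single (awgn m n b) (par.σ : ℂ)

/-- Coefficients of antenna `b` of the aged channel at the instant `n`. -/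
noncomputable def chanCoeff (m : Fin M) (k : Fin K) (n : ℕ) (b : Fin N) : RayleighSrc M K N →₀ ℂ :=
  (par.ρ k ((par.lam : ℤ) - n) : ℂ) • par.lamCoeff m k b
    + (par.ρbar k ((par.lam : ℤ) - n) : ℂ) • par.innovCoeff m k n b

/-- Coefficients of antenna `b` of the pilot signal received by AP `m` at the instant `t_k`. -/
noncomputable def pilotCoeff (m : Fin M) (k : Fin K) (b : Fin N) : RayleighSrc M K N →₀ ℂ :=
  ∑ i ∈ par.copilot k, (Real.sqrt (par.pp i) : ℂ) • par.chanCoeff m i (par.t k) b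
    + par.noiseCoeff m (par.t k) b

/-- Power per antenna of the pilot signal received by AP `m` at the instant `t_k`. -/
noncomputable def pilotPower (m : Fin M) (k : Fin K) : ℝ :=
  ∑ i ∈ par.copilot k, par.pp i * par.β m i + par.σ ^ 2

/-- The scalar LMMSE filter that estimates the channel from the pilot signal. -/
noncomputable def lmmseGain (m : Fin M) (k : Fin K) : ℝ :=
  Real.sqrt (par.pp k) * par.ρ k ((par.lam : ℤ) - par.t k) * par.β m k / par.pilotPower m k

variable {par}

lemma self_mem_copilot (k : Fin K) : k ∈ par.copilot k := by simp [copilot]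

lemma copilot_congr {i k : Fin K} (h : i ∈ par.copilot k) : par.copilot i = par.copilot k := by
  have : par.pilotIdx i = par.pilotIdx k := by simpa [copilot] using h
  simp [copilot, this]

lemma t_congr {i k : Fin K} (h : i ∈ par.copilot k) : par.t i = par.t k := by
  have : par.pilotIdx i = par.pilotIdx k := by simpa [copilot] using h
  simp [t, this]

lemma t_lt_lam (k : Fin K) : par.t k < par.lam := by simp [t, lam]

section Covariance

lemma Admissible.pilotPower_pos (hpar : par.Admissible) (m : Fin M) (k : Fin K) :
    0 < par.pilotPower m k :=
  add_pos_of_nonneg_of_pos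
    (Finset.sum_nonneg fun i _ ↦ mul_nonneg (hpar.pp_nonneg i) (hpar.β_pos m i).le)
    (pow_pos hpar.σ_pos 2)

lemma Admissible.ofReal_sqrt_β_mul_self (hpar : par.Admissible) (m : Fin M) (k : Fin K) :
    (Real.sqrt (par.β m k) : ℂ) * (Real.sqrt (par.β m k) : ℂ) = par.β m k := by
  rw [← Complex.ofReal_mul, Real.mul_self_sqrt (hpar.β_pos m k).le]

lemma Admissible.ofReal_sqrt_pp_mul_self (hpar : par.Admissible) (k : Fin K) :
    (Real.sqrt (par.pp k) : ℂ) * (Real.sqrt (par.pp k) : ℂ) = par.pp k := by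
  rw [← Complex.ofReal_mul, Real.mul_self_sqrt (hpar.pp_nonneg k)]

lemma ofReal_ρ_sq_add_ρbar_sq (k : Fin K) (d : ℤ) :
    (par.ρ k d : ℂ) * par.ρ k d + (par.ρbar k d : ℂ) * par.ρbar k d = 1 := by
  have := par.ρ_sq_add_ρbar_sq k d
  rw [sq, sq] at this
  exact_mod_cast this

lemma coeffInner_lamCoeff (hpar : par.Admissible) (m m' : Fin M) (k : Fin K) (b b' : Fin N) :
    coeffInner (par.lamCoeff m k b) (par.lamCoeff m' k b') =
      if (m, b) = (m', b') then (par.β m k : ℂ) else 0 := by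
  simp only [lamCoeff, coeffInner_single_single, fading.injEq, Prod.mk.injEq, true_and]
  split_ifs with h
  · obtain ⟨rfl, rfl⟩ := h
    simpa using hpar.ofReal_sqrt_β_mul_self m k
  · rfl

lemma coeffInner_innovCoeff (hpar : par.Admissible) (m m' : Fin M) (k : Fin K) (n : ℕ)
    (b b' : Fin N) :
    coeffInner (par.innovCoeff m k n b) (par.innovCoeff m' k n b') =
      if (m, b) = (m', b') then (par.β m k : ℂ) else 0 := by
  simp only [innovCoeff, coeffInner_single_single, innov.injEq, Prod.mk.injEq, true_and]
  split_ifs with h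
  · obtain ⟨rfl, rfl⟩ := h
    simpa using hpar.ofReal_sqrt_β_mul_self m k
  · rfl

lemma coeffInner_noiseCoeff (m m' : Fin M) (n : ℕ) (b b' : Fin N) :
    coeffInner (par.noiseCoeff m n b) (par.noiseCoeff m' n b') =
      if (m, b) = (m', b') then ((par.σ ^ 2 : ℝ) : ℂ) else 0 := by
  simp only [noiseCoeff, coeffInner_single_single, awgn.injEq, Prod.mk.injEq, true_and]
  split_ifs with h
  · simp [sq]
  · rfl

lemma coeffInner_chanCoeff (hpar : par.Admissible) (m m' : Fin M) (i j : Fin K) (n : ℕ)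
    (b b' : Fin N) :
    coeffInner (par.chanCoeff m i n b) (par.chanCoeff m' j n b') =
      if i = j then if (m, b) = (m', b') then (par.β m i : ℂ) else 0 else 0 := by
  split_ifs with h h'
  · obtain ⟨rfl, rfl⟩ := Prod.mk.inj h'
    subst h
    have h1 := coeffInner_lamCoeff hpar m m i b b
    have h2 := coeffInner_innovCoeff hpar m m i n b b
    simp only [if_true] at h1 h2
    simp only [chanCoeff, coeffInner_add_left, coeffInner_add_right, coeffInner_smul_left,
      coeffInner_smul_right, h1, h2]
    simp only [lamCoeff, innovCoeff, coeffInner_single_single]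
    have h3 := ofReal_ρ_sq_add_ρbar_sq (par := par) i ((par.lam : ℤ) - n)
    simp
    linear_combination (par.β m i : ℂ) * h3
  · subst h
    have h1 := coeffInner_lamCoeff hpar m m' i b b'
    have h2 := coeffInner_innovCoeff hpar m m' i n b b'
    simp only [if_neg h'] at h1 h2
    simp only [chanCoeff, coeffInner_add_left, coeffInner_add_right, coeffInner_smul_left,
      coeffInner_smul_right, h1, h2]
    simp [lamCoeff, innovCoeff, coeffInner_single_single]
  · simp [chanCoeff, lamCoeff, innovCoeff, coeffInner_single_single, h,
      -Complex.coe_smul, -Finsupp.smul_single]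

lemma coeffInner_pilotCoeff (hpar : par.Admissible) (m m' : Fin M) (k : Fin K) (b b' : Fin N) :
    coeffInner (par.pilotCoeff m k b) (par.pilotCoeff m' k b') =
      if (m, b) = (m', b') then (par.pilotPower m k : ℂ) else 0 := by
  have hcn (i : Fin K) : coeffInner (par.chanCoeff m i (par.t k) b)
      (par.noiseCoeff m' (par.t k) b') = 0 := by
    simp [chanCoeff, lamCoeff, innovCoeff, noiseCoeff, coeffInner_single_single,
      -Complex.coe_smul, -Finsupp.smul_single]
  have hnc (i : Fin K) : coeffInner (par.noiseCoeff m (par.t k) b)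
      (par.chanCoeff m' i (par.t k) b') = 0 := by
    simp [chanCoeff, lamCoeff, innovCoeff, noiseCoeff, coeffInner_single_single,
      -Complex.coe_smul, -Finsupp.smul_single]
  simp only [pilotCoeff, coeffInner_add_left, coeffInner_add_right, coeffInner_sum_left,
    coeffInner_sum_right, coeffInner_smul_left, coeffInner_smul_right, hcn, hnc,
    coeffInner_noiseCoeff, coeffInner_chanCoeff hpar, mul_zero, Finset.sum_const_zero, add_zero,
    zero_add]
  split_ifs with h
  · simp only [pilotPower, Complex.ofReal_add, Complex.ofReal_sum, Complex.ofReal_mul]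
    congr 1
    refine Finset.sum_congr rfl fun i hi ↦ ?_
    simp only [mul_ite, mul_zero, Finset.sum_ite_eq', hi, if_true]
    rw [← hpar.ofReal_sqrt_pp_mul_self i]
    simp [mul_assoc]
  · simp

lemma coeffInner_pilotCoeff_lamCoeff (hpar : par.Admissible) (m : Fin M) (k : Fin K)
    (b b' : Fin N) :
    coeffInner (par.pilotCoeff m k b) (par.lamCoeff m k b') =
      if b = b' then
        ((Real.sqrt (par.pp k) * par.ρ k ((par.lam : ℤ) - par.t k) * par.β m k : ℝ) : ℂ)
      else 0 := by
  have h1 (i : Fin K) : coeffInner (par.chanCoeff m i (par.t k) b) (par.lamCoeff m k b') =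
      if i = k then if b = b' then
        (par.ρ k ((par.lam : ℤ) - par.t k) * par.β m k : ℂ) else 0 else 0 := by
    by_cases hi : i = k
    · subst hi
      have := coeffInner_lamCoeff hpar m m i b b'
      simp only [chanCoeff, coeffInner_add_left, coeffInner_smul_left, this]
      simp [innovCoeff, lamCoeff, coeffInner_single_single]
    · simp [chanCoeff, lamCoeff, innovCoeff, coeffInner_single_single, hi,
      -Complex.coe_smul, -Finsupp.smul_single]
  have h2 : coeffInner (par.noiseCoeff m (par.t k) b) (par.lamCoeff m k b') = 0 := by
    simp [noiseCoeff, lamCoeff, coeffInner_single_single]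
  simp only [pilotCoeff, coeffInner_add_left, coeffInner_sum_left, coeffInner_smul_left, h1, h2]
  simp only [mul_ite, mul_zero, Finset.sum_ite_eq', self_mem_copilot, if_true, add_zero]
  split_ifs
  · simp [mul_assoc]
  · rfl

/-- The pilot signal is correlated with a later aged channel through the fading at the instant
`λ` only, and only for a user that shares the pilot instant. -/
lemma coeffInner_pilotCoeff_chanCoeff (hpar : par.Admissible) (m : Fin M) (k i : Fin K) {n : ℕ}
    (hn : par.lam ≤ n) (b : Fin N) :
    coeffInner (par.pilotCoeff m k b) (par.chanCoeff m i n b) =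
      if i ∈ par.copilot k then
        ((Real.sqrt (par.pp i) * par.ρ i ((par.lam : ℤ) - par.t i) *
          par.ρ i ((par.lam : ℤ) - n) * par.β m i : ℝ) : ℂ) else 0 := by
  have ht : par.t k ≠ n := ((t_lt_lam k).trans_le hn).ne
  have h1 (j : Fin K) : coeffInner (par.chanCoeff m j (par.t k) b) (par.chanCoeff m i n b) =
      if j = i then (par.ρ i ((par.lam : ℤ) - par.t k) * par.ρ i ((par.lam : ℤ) - n) *
        par.β m i : ℂ) else 0 := by
    by_cases hi : j = i
    · subst hi
      have := coeffInner_lamCoeff hpar m m j b b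
      simp only [chanCoeff, coeffInner_add_left, coeffInner_smul_left, coeffInner_add_right,
        coeffInner_smul_right, this]
      simp [innovCoeff, lamCoeff, coeffInner_single_single, ht]
      ring
    · simp [chanCoeff, lamCoeff, innovCoeff, coeffInner_single_single, hi,
      -Complex.coe_smul, -Finsupp.smul_single]
  have h2 : coeffInner (par.noiseCoeff m (par.t k) b) (par.chanCoeff m i n b) = 0 := by
    simp [noiseCoeff, chanCoeff, lamCoeff, innovCoeff, coeffInner_single_single,
      -Complex.coe_smul, -Finsupp.smul_single]
  simp only [pilotCoeff, coeffInner_add_left, coeffInner_sum_left, coeffInner_smul_left, h1, h2]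
  simp only [mul_ite, mul_zero, Finset.sum_ite_eq', add_zero]
  split_ifs with hi
  · simp [t_congr hi, mul_assoc]
  · rfl

lemma coeffInner_pilotCoeff_innovCoeff (m : Fin M) (k : Fin K) {n : ℕ} (hn : par.lam ≤ n)
    (b : Fin N) : coeffInner (par.pilotCoeff m k b) (par.innovCoeff m k n b) = 0 := by
  have ht : par.t k ≠ n := ((t_lt_lam k).trans_le hn).ne
  simp [pilotCoeff, noiseCoeff, chanCoeff, lamCoeff, innovCoeff, coeffInner_single_single, ht,
      -Complex.coe_smul, -Finsupp.smul_single]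

lemma coeffInner_pilotCoeff_noiseCoeff (m : Fin M) (k : Fin K) {n : ℕ} (hn : par.lam ≤ n)
    (b : Fin N) : coeffInner (par.pilotCoeff m k b) (par.noiseCoeff m n b) = 0 := by
  have ht : par.t k ≠ n := ((t_lt_lam k).trans_le hn).ne
  simp [pilotCoeff, noiseCoeff, chanCoeff, lamCoeff, innovCoeff, coeffInner_single_single, ht,
      -Complex.coe_smul, -Finsupp.smul_single]

end Covariance

namespace IdealRayleigh

lemma αd_eq (h : par.IdealRayleigh) (k : Fin K) : par.αd k = 1 := by simp [αd, h.dac]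

lemma A_eq (h : par.IdealRayleigh) (m : Fin M) : par.A m = 1 := by
  simp [A, h.adc, ← Matrix.diagonal_one]

lemma B_eq (h : par.IdealRayleigh) (m : Fin M) : par.B m = 0 := by simp [B, h.A_eq]

lemma hbar_eq (h : par.IdealRayleigh) (m : Fin M) (k : Fin K) : par.hbar m k = 0 := by
  funext b; simp [hbar, h.rician_zero]

lemma Rbar_eq (h : par.IdealRayleigh) (m : Fin M) (k : Fin K) :
    par.Rbar m k = (par.β m k : ℂ) • (1 : Matrix (Fin N) (Fin N) ℂ) := by
  simp [Rbar, h.hbar_eq, h.uncorrelated]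

lemma sqrt_R_eq (h : par.IdealRayleigh) (hpar : par.Admissible) (m : Fin M) (k : Fin K) :
    CFC.sqrt (par.R m k) =
      (Real.sqrt (par.β m k) : ℂ) • (1 : Matrix (Fin N) (Fin N) ℂ) := by
  refine CFC.sqrt_unique ?_ ?_
  · rw [h.uncorrelated, smul_mul_smul_comm, one_mul, hpar.ofReal_sqrt_β_mul_self]
  · rw [Matrix.nonneg_iff_posSemidef]
    exact Matrix.PosSemidef.one.smul (by exact_mod_cast Real.sqrt_nonneg _)

variable {Ω : Type*} (X : Src M K N → Ω → ℂ)

lemma chanLam_eq (h : par.IdealRayleigh) (hpar : par.Admissible) (m : Fin M) (k : Fin K) (ω : Ω) :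
    par.chanLam X m k ω = fun b ↦ linForm (fun s : RayleighSrc M K N ↦ X s.toSrc)
      (par.lamCoeff m k b) ω := by
  funext b
  simp [chanLam, h.hbar_eq, h.sqrt_R_eq hpar, lamCoeff, smul_mulVec, toSrc]

lemma innovation_eq (h : par.IdealRayleigh) (hpar : par.Admissible) (m : Fin M) (k : Fin K)
    (n : ℕ) (ω : Ω) :
    par.innovation X m k n ω = fun b ↦ linForm (fun s : RayleighSrc M K N ↦ X s.toSrc)
      (par.innovCoeff m k n b) ω := by
  funext b
  simp [innovation, h.hbar_eq, h.sqrt_R_eq hpar, innovCoeff, smul_mulVec, toSrc]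

lemma chan_eq (h : par.IdealRayleigh) (hpar : par.Admissible) (m : Fin M) (k : Fin K)
    (n : ℕ) (ω : Ω) :
    par.chan X m k n ω = fun b ↦ linForm (fun s : RayleighSrc M K N ↦ X s.toSrc)
      (par.chanCoeff m k n b) ω := by
  funext b
  simp [chan, h.chanLam_eq X hpar, h.innovation_eq X hpar, chanCoeff,
      -Complex.coe_smul]

lemma noise_eq (m : Fin M) (n : ℕ) (ω : Ω) :
    par.noise X m n ω = fun b ↦ linForm (fun s : RayleighSrc M K N ↦ X s.toSrc)
      (par.noiseCoeff m n b) ω := by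
  funext b
  simp [noise, noiseCoeff, toSrc]

lemma dacNoise_eq (h : par.IdealRayleigh) (q : ℝ) (k : Fin K) (n : ℕ) (ω : Ω) :
    par.dacNoise X q k n ω = 0 := by
  simp [dacNoise, h.αd_eq]

lemma txDistortion_eq (h : par.IdealRayleigh) (q : ℝ) (k : Fin K) (n : ℕ) (ω : Ω) :
    par.txDistortion X q k n ω = 0 := by
  simp [txDistortion, h.transmit_rf]

lemma rxDistortion_eq (h : par.IdealRayleigh) (U : Finset (Fin K)) (q : Fin K → ℝ) (m : Fin M)
    (n : ℕ) (ω : Ω) : par.rxDistortion X U q m n ω = 0 := by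
  funext b; simp [rxDistortion, h.receive_rf]

lemma adcNoise_eq (h : par.IdealRayleigh) (U : Finset (Fin K)) (q : Fin K → ℝ) (m : Fin M)
    (n : ℕ) (ω : Ω) : par.adcNoise X U q m n ω = 0 := by
  funext b; simp [adcNoise, h.adc]

lemma yPilot_eq (h : par.IdealRayleigh) (hpar : par.Admissible) (m : Fin M) (k : Fin K) (ω : Ω) :
    par.yPilot X m k ω = fun b ↦ linForm (fun s : RayleighSrc M K N ↦ X s.toSrc)
      (par.pilotCoeff m k b) ω := by
  funext b
  simp [yPilot, h.A_eq, h.rxDistortion_eq, h.adcNoise_eq, pilot, h.dacNoise_eq, h.txDistortion_eq,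
    h.αd_eq, h.chan_eq X hpar, noise_eq, pilotCoeff,
      -Complex.coe_smul]

variable [MeasurableSpace Ω] {P : Measure Ω} {X}

lemma Chy_eq (h : par.IdealRayleigh) (hpar : par.Admissible) (hX : IsSourceFamily P X) (m : Fin M)
    (k : Fin K) : par.Chy X P m k =
      ((Real.sqrt (par.pp k) * par.ρ k ((par.lam : ℤ) - par.t k) * par.β m k : ℝ) : ℂ) • 1 := by
  ext b b'
  simp only [Chy, of_apply, h.chanLam_eq X hpar, h.yPilot_eq X hpar]
  simp_rw [mul_comm (linForm _ _ _)]
  rw [hX.isStdComplexGaussianFamily.integral_star_linForm_mul,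
    coeffInner_pilotCoeff_lamCoeff hpar, Matrix.smul_apply, Matrix.one_apply]
  simp only [eq_comm (a := b), smul_eq_mul, mul_ite, mul_one, mul_zero]

lemma Cyy_eq (h : par.IdealRayleigh) (hpar : par.Admissible) (hX : IsSourceFamily P X) (m : Fin M)
    (k : Fin K) : par.Cyy X P m k = (par.pilotPower m k : ℂ) • 1 := by
  ext b b'
  simp only [Cyy, of_apply, h.yPilot_eq X hpar]
  simp_rw [mul_comm (linForm _ _ _)]
  rw [hX.isStdComplexGaussianFamily.integral_star_linForm_mul,
    coeffInner_pilotCoeff hpar, Matrix.smul_apply, Matrix.one_apply]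
  simp only [eq_comm (a := b), smul_eq_mul, mul_ite, mul_one, mul_zero, Prod.mk.injEq, true_and]

lemma ofReal_smul_one_inv {r : ℝ} (hr : r ≠ 0) :
    ((r : ℂ) • (1 : Matrix (Fin N) (Fin N) ℂ))⁻¹ = ((r⁻¹ : ℝ) : ℂ) • 1 := by
  refine Matrix.inv_eq_left_inv ?_
  rw [smul_mul_smul_comm, one_mul, ← Complex.ofReal_mul, inv_mul_cancel₀ hr]
  simp

lemma hhat_eq (h : par.IdealRayleigh) (hpar : par.Admissible) (hX : IsSourceFamily P X) (m : Fin M)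
    (k : Fin K) (ω : Ω) :
    par.hhat X P m k ω = (par.lmmseGain m k : ℂ) • par.yPilot X m k ω := by
  rw [hhat, h.Chy_eq hpar hX, h.Cyy_eq hpar hX, ofReal_smul_one_inv (hpar.pilotPower_pos m k).ne',
    smul_mul_smul_comm, one_mul, smul_mulVec, one_mulVec, ← Complex.ofReal_mul, lmmseGain,
    div_eq_mul_inv]

lemma γbar_eq (h : par.IdealRayleigh) (hN : 0 < N) (hpar : par.Admissible) (m : Fin M)
    (k : Fin K) : par.γbar m k = par.pp k * par.ρ k ((par.lam : ℤ) - par.t k) ^ 2 *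
      par.β m k ^ 2 / par.pilotPower m k := by
  have hΨ : par.Ψ m k = (((par.pilotPower m k)⁻¹ : ℝ) : ℂ) • 1 := by
    rw [← ofReal_smul_one_inv (hpar.pilotPower_pos m k).ne', Ψ]
    congr 1
    simp [h.αd_eq, h.A_eq, h.B_eq, h.Rbar_eq, h.transmit_rf, h.receive_rf, pilotPower, add_smul,
      Finset.sum_smul, smul_smul,
      -Complex.coe_smul]
  have hN' : (N : ℝ) ≠ 0 := by positivity
  rw [γbar, Γbar, hΨ, h.A_eq, h.Rbar_eq, h.αd_eq]
  simp only [Matrix.mul_one, smul_mul_smul_comm, Matrix.trace_smul, Matrix.trace_one,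
    Fintype.card_fin, smul_eq_mul, ← Complex.ofReal_mul, ← Complex.ofReal_natCast,
    Complex.ofReal_re]
  field_simp

lemma lmmseGain_sq_mul (h : par.IdealRayleigh) (hN : 0 < N) (hpar : par.Admissible) (m : Fin M)
    (k : Fin K) : par.lmmseGain m k ^ 2 * par.pilotPower m k = par.γbar m k := by
  have := (hpar.pilotPower_pos m k).ne'
  rw [h.γbar_eq hN hpar, lmmseGain]
  field_simp
  rw [Real.sq_sqrt (hpar.pp_nonneg k)]
  ring

end IdealRayleigh

end CFParams

/-! ### The use-and-then-forget SINR -/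

namespace CFParams.IdealRayleigh

variable {M K N : ℕ} {par : CFParams M K N} {Ω : Type*} [MeasurableSpace Ω] {P : Measure Ω}
  {X : Src M K N → Ω → ℂ}

/-- Combining linear forms with the LMMSE estimates gives a bilinear form in the pilot signals. -/
lemma combine_eq (h : par.IdealRayleigh) (hpar : par.Admissible) (hX : IsSourceFamily P X)
    (a : Fin M → ℂ) (k : Fin K) (v : Fin M → Fin N → RayleighSrc M K N →₀ ℂ) :
    par.combine X P a k (fun m ω b ↦ linForm (fun s : RayleighSrc M K N ↦ X s.toSrc) (v m b) ω) =
      bilinForm (fun s : RayleighSrc M K N ↦ X s.toSrc)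
        (fun q : Fin M × Fin N ↦ star (a q.1) * (par.lmmseGain q.1 k : ℂ))
        (fun q ↦ par.pilotCoeff q.1 k q.2) (fun q ↦ v q.1 q.2) := by
  funext ω
  simp only [combine, bilinForm, h.hhat_eq hpar hX, h.yPilot_eq X hpar, Fintype.sum_prod_type,
    dotProduct, Finset.mul_sum]
  refine Finset.sum_congr rfl fun m _ ↦ Finset.sum_congr rfl fun b _ ↦ ?_
  simp
  ring

lemma memLp_combine (h : par.IdealRayleigh) (hpar : par.Admissible) (hX : IsSourceFamily P X)
    (a : Fin M → ℂ) (k : Fin K) (v : Fin M → Fin N → RayleighSrc M K N →₀ ℂ) :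
    MemLp (par.combine X P a k
      (fun m ω b ↦ linForm (fun s : RayleighSrc M K N ↦ X s.toSrc) (v m b) ω)) 2 P := by
  rw [h.combine_eq hpar hX]
  exact hX.isStdComplexGaussianFamily.memLp_bilinForm _ _ _

/-- Mean power after combining the per-antenna signals `v m b`, uncorrelated between antennas, of
variance `V m` and covariance `C m` with the pilot signal. -/
lemma power_combine [IsProbabilityMeasure P] (h : par.IdealRayleigh) (hN : 0 < N)
    (hpar : par.Admissible) (hX : IsSourceFamily P X)
    (a : Fin M → ℂ) (k : Fin K) (v : Fin M → Fin N → RayleighSrc M K N →₀ ℂ) (V C : Fin M → ℝ)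
    (hV : ∀ m m' b b', coeffInner (v m b) (v m' b') =
      if (m, b) = (m', b') then (V m : ℂ) else 0)
    (hC : ∀ m b, coeffInner (par.pilotCoeff m k b) (v m b) = C m) :
    power P (par.combine X P a k
      (fun m ω b ↦ linForm (fun s : RayleighSrc M K N ↦ X s.toSrc) (v m b) ω)) =
      ‖∑ m, star (a m) * ((N * (par.lmmseGain m k * C m) : ℝ) : ℂ)‖ ^ 2
        + ∑ m, ‖a m‖ ^ 2 * (N * par.γbar m k * V m) := by
  rw [h.combine_eq hpar hX, hX.isStdComplexGaussianFamily.power_bilinForm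
    (fun q : Fin M × Fin N ↦ star (a q.1) * (par.lmmseGain q.1 k : ℂ))
    (fun q ↦ par.pilotCoeff q.1 k q.2) (fun q ↦ v q.1 q.2) (fun q ↦ par.pilotPower q.1 k)
    (fun q ↦ V q.1) (fun q ↦ C q.1)
    (fun p q ↦ coeffInner_pilotCoeff hpar _ _ _ _ _) (fun p q ↦ hV _ _ _ _) (fun p ↦ hC _ _)]
  simp only [Fintype.sum_prod_type, Finset.sum_const, Finset.card_univ, Fintype.card_fin,
    nsmul_eq_mul]
  congr 1
  · congr 2
    refine Finset.sum_congr rfl fun m _ ↦ ?_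
    push_cast; ring
  · refine Finset.sum_congr rfl fun m _ ↦ ?_
    rw [← h.lmmseGain_sq_mul hN hpar, norm_mul, norm_star, Complex.norm_real, mul_pow,
      Real.norm_eq_abs, sq_abs]
    ring

lemma lmmseGain_mul_eq_γbar (h : par.IdealRayleigh) (hN : 0 < N) (hpar : par.Admissible)
    (m : Fin M) (k : Fin K) : par.lmmseGain m k *
      (Real.sqrt (par.pp k) * par.ρ k ((par.lam : ℤ) - par.t k) * par.β m k) = par.γbar m k := by
  have := (hpar.pilotPower_pos m k).ne'
  rw [h.γbar_eq hN hpar, lmmseGain]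
  field_simp
  rw [Real.sq_sqrt (hpar.pp_nonneg k)]
  ring

lemma star_hhat_dotProduct_eq (h : par.IdealRayleigh) (hpar : par.Admissible)
    (hX : IsSourceFamily P X) (m : Fin M) (k : Fin K) :
    (fun ω ↦ star (par.hhat X P m k ω) ⬝ᵥ (par.A m *ᵥ par.chanLam X m k ω)) =
      bilinForm (fun s : RayleighSrc M K N ↦ X s.toSrc)
        (fun _ : Fin N ↦ (par.lmmseGain m k : ℂ))
        (fun b ↦ par.pilotCoeff m k b) (fun b ↦ par.lamCoeff m k b) := by
  funext ω
  simp only [bilinForm, h.hhat_eq hpar hX, h.yPilot_eq X hpar, h.A_eq, one_mulVec,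
    h.chanLam_eq X hpar, dotProduct]
  refine Finset.sum_congr rfl fun b _ ↦ ?_
  simp
  ring

lemma meanGain_eq [IsProbabilityMeasure P] (h : par.IdealRayleigh) (hN : 0 < N)
    (hpar : par.Admissible) (hX : IsSourceFamily P X) (m : Fin M) (k : Fin K) :
    par.meanGain X P m k = ((N * par.γbar m k : ℝ) : ℂ) := by
  rw [meanGain, h.star_hhat_dotProduct_eq hpar hX,
    hX.isStdComplexGaussianFamily.integral_bilinForm, ← h.lmmseGain_mul_eq_γbar hN hpar]
  simp [coeffInner_pilotCoeff_lamCoeff hpar]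

lemma sigDS_eq [IsProbabilityMeasure P] (h : par.IdealRayleigh) (hN : 0 < N)
    (hpar : par.Admissible) (hX : IsSourceFamily P X) (a : Fin M → ℂ) (k : Fin K) (n : ℕ) :
    ‖par.sigDS X P a k n‖ ^ 2 = par.p k * par.ρ k ((n : ℤ) - par.lam) ^ 2 *
      ‖∑ m, star (a m) * ((N * par.γbar m k : ℝ) : ℂ)‖ ^ 2 := by
  have e : par.sigDS X P a k n =
      ((par.ρ k ((n : ℤ) - par.lam) * Real.sqrt (par.p k) : ℝ) : ℂ) *
        ∑ m, star (a m) * ((N * par.γbar m k : ℝ) : ℂ) := by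
    rw [sigDS, Finset.mul_sum]
    refine Finset.sum_congr rfl fun m _ ↦ ?_
    rw [h.meanGain_eq hN hpar hX, h.αd_eq]
    push_cast; ring
  rw [e, norm_mul, mul_pow, Complex.norm_real, Real.norm_eq_abs, sq_abs, mul_pow,
    Real.sq_sqrt (hpar.p_nonneg k)]
  ring

lemma integral_combine_lamCoeff [IsProbabilityMeasure P] (h : par.IdealRayleigh) (hN : 0 < N)
    (hpar : par.Admissible) (hX : IsSourceFamily P X) (a : Fin M → ℂ) (k : Fin K) :
    ∫ ω', par.combine X P a k (fun m ω b ↦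
      linForm (fun s : RayleighSrc M K N ↦ X s.toSrc) (par.lamCoeff m k b) ω) ω' ∂P =
      ∑ m, star (a m) * ((N * par.γbar m k : ℝ) : ℂ) := by
  simp only [h.combine_eq hpar hX]
  rw [hX.isStdComplexGaussianFamily.integral_bilinForm]
  simp only [Fintype.sum_prod_type, coeffInner_pilotCoeff_lamCoeff hpar, if_true,
    Finset.sum_const, Finset.card_univ, Fintype.card_fin, nsmul_eq_mul]
  refine Finset.sum_congr rfl fun m _ ↦ ?_
  rw [← h.lmmseGain_mul_eq_γbar hN hpar]
  push_cast; ring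

lemma sigBU_eq [IsProbabilityMeasure P] (h : par.IdealRayleigh) (hN : 0 < N)
    (hpar : par.Admissible) (hX : IsSourceFamily P X) (a : Fin M → ℂ) (k : Fin K) (n : ℕ) :
    par.sigBU X P a k n = fun ω ↦ ((par.ρ k ((n : ℤ) - par.lam) * Real.sqrt (par.p k) : ℝ) : ℂ) *
      (par.combine X P a k (fun m ω b ↦ linForm (fun s : RayleighSrc M K N ↦ X s.toSrc)
        (par.lamCoeff m k b) ω) ω - ∫ ω', par.combine X P a k (fun m ω b ↦
          linForm (fun s : RayleighSrc M K N ↦ X s.toSrc) (par.lamCoeff m k b) ω) ω' ∂P) := by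
  funext ω
  rw [h.integral_combine_lamCoeff hN hpar hX]
  simp only [sigBU, combine, h.A_eq, one_mulVec, h.chanLam_eq X hpar, h.αd_eq,
    h.meanGain_eq hN hpar hX]
  rw [← Finset.sum_sub_distrib, Finset.mul_sum]
  refine Finset.sum_congr rfl fun m _ ↦ ?_
  push_cast; ring

lemma sigCA_eq (h : par.IdealRayleigh) (hpar : par.Admissible) (a : Fin M → ℂ) (k : Fin K)
    (n : ℕ) : par.sigCA X P a k n = fun ω ↦
      ((par.ρbar k ((n : ℤ) - par.lam) * Real.sqrt (par.p k) : ℝ) : ℂ) *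
      par.combine X P a k (fun m ω b ↦ linForm (fun s : RayleighSrc M K N ↦ X s.toSrc)
        (par.innovCoeff m k n b) ω) ω := by
  funext ω
  simp [sigCA, h.A_eq, h.αd_eq, h.innovation_eq X hpar]

lemma sigIUI_eq (h : par.IdealRayleigh) (hpar : par.Admissible) (a : Fin M → ℂ) (k i : Fin K)
    (n : ℕ) : par.sigIUI X P a k i n = fun ω ↦ ((Real.sqrt (par.p i) : ℝ) : ℂ) *
      par.combine X P a k (fun m ω b ↦ linForm (fun s : RayleighSrc M K N ↦ X s.toSrc)
        (par.chanCoeff m i n b) ω) ω := by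
  funext ω
  simp [sigIUI, h.A_eq, h.αd_eq, h.chan_eq X hpar]

lemma sigNS_eq (h : par.IdealRayleigh) (a : Fin M → ℂ) (k : Fin K)
    (n : ℕ) : par.sigNS X P a k n =
      par.combine X P a k (fun m ω b ↦ linForm (fun s : RayleighSrc M K N ↦ X s.toSrc)
        (par.noiseCoeff m n b) ω) := by
  funext ω
  simp [sigNS, h.A_eq, noise_eq]

lemma sigDAC_eq (h : par.IdealRayleigh) (a : Fin M → ℂ) (k : Fin K) (n : ℕ) :
    par.sigDAC X P a k n = fun _ ↦ 0 := by
  funext ω; simp [sigDAC, combine, h.dacNoise_eq]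

lemma sigTRF_eq (h : par.IdealRayleigh) (a : Fin M → ℂ) (k : Fin K) (n : ℕ) :
    par.sigTRF X P a k n = fun _ ↦ 0 := by
  funext ω; simp [sigTRF, combine, h.txDistortion_eq]

lemma sigRRF_eq (h : par.IdealRayleigh) (a : Fin M → ℂ) (k : Fin K) (n : ℕ) :
    par.sigRRF X P a k n = fun _ ↦ 0 := by
  funext ω; simp [sigRRF, combine, h.rxDistortion_eq]

lemma sigADC_eq (h : par.IdealRayleigh) (a : Fin M → ℂ) (k : Fin K) (n : ℕ) :
    par.sigADC X P a k n = fun _ ↦ 0 := by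
  funext ω; simp [sigADC, combine, h.adcNoise_eq]

theorem sinrWellDefined [IsProbabilityMeasure P] (h : par.IdealRayleigh) (hN : 0 < N)
    (hpar : par.Admissible) (hX : IsSourceFamily P X) (a : Fin M → ℂ) (k : Fin K) (n : ℕ) :
    par.SinrWellDefined X P a k n where
  chan m b := by
    simp only [h.chanLam_eq X hpar]
    exact hX.isStdComplexGaussianFamily.memLp_linForm _ 2 (by simp)
  pilot m b := by
    simp only [h.yPilot_eq X hpar]
    exact hX.isStdComplexGaussianFamily.memLp_linForm _ 2 (by simp)
  cov m := by
    rw [h.Cyy_eq hpar hX, det_smul, det_one, mul_one, isUnit_iff_ne_zero]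
    exact pow_ne_zero _ (by exact_mod_cast (hpar.pilotPower_pos m k).ne')
  gain m := by
    rw [h.star_hhat_dotProduct_eq hpar hX]
    exact (hX.isStdComplexGaussianFamily.memLp_bilinForm _ _ _).integrable (by simp)
  bu := by
    rw [h.sigBU_eq hN hpar hX]
    exact ((h.memLp_combine hpar hX a k _).sub (memLp_const _)).const_mul _
  ca := by
    rw [h.sigCA_eq hpar]
    exact (h.memLp_combine hpar hX a k _).const_mul _
  iui i _ := by
    rw [h.sigIUI_eq hpar]
    exact (h.memLp_combine hpar hX a k _).const_mul _
  dac := by rw [h.sigDAC_eq]; exact memLp_const 0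
  trf := by rw [h.sigTRF_eq]; exact memLp_const 0
  rrf := by rw [h.sigRRF_eq]; exact memLp_const 0
  adc := by rw [h.sigADC_eq]; exact memLp_const 0
  ns := by
    rw [h.sigNS_eq]
    exact h.memLp_combine hpar hX a k _

section Power

variable [IsProbabilityMeasure P]

/-- Only the incoherent part remains, since the coherent part of the power is the squared mean that
is subtracted. -/
lemma power_sigBU (h : par.IdealRayleigh) (hN : 0 < N)
    (hpar : par.Admissible) (hX : IsSourceFamily P X) (a : Fin M → ℂ) (k : Fin K) (n : ℕ) :
    power P (par.sigBU X P a k n) = par.p k * par.ρ k ((n : ℤ) - par.lam) ^ 2 *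
      ∑ m, ‖a m‖ ^ 2 * (N * par.γbar m k * par.β m k) := by
  have hpow := h.power_combine hN hpar hX a k (fun m b ↦ par.lamCoeff m k b) (fun m ↦ par.β m k)
    (fun m ↦ Real.sqrt (par.pp k) * par.ρ k ((par.lam : ℤ) - par.t k) * par.β m k)
    (fun m m' b b' ↦ coeffInner_lamCoeff hpar m m' k b b')
    (fun m b ↦ by rw [coeffInner_pilotCoeff_lamCoeff hpar, if_pos rfl])
  rw [h.sigBU_eq hN hpar hX, power_const_mul, power_sub_integral P (h.memLp_combine hpar hX a k _),
    hpow, h.integral_combine_lamCoeff hN hpar hX]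
  simp only [h.lmmseGain_mul_eq_γbar hN hpar]
  rw [add_sub_cancel_left, Complex.norm_real, Real.norm_eq_abs, sq_abs, mul_pow,
    Real.sq_sqrt (hpar.p_nonneg k)]
  ring

/-- The innovation at a data instant is independent of the pilot signal, so that the power has no
coherent part. -/
lemma power_sigCA (h : par.IdealRayleigh) (hN : 0 < N) (hpar : par.Admissible)
    (hX : IsSourceFamily P X) (a : Fin M → ℂ) (k : Fin K) {n : ℕ} (hn : par.lam ≤ n) :
    power P (par.sigCA X P a k n) = par.p k * par.ρbar k ((n : ℤ) - par.lam) ^ 2 *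
      ∑ m, ‖a m‖ ^ 2 * (N * par.γbar m k * par.β m k) := by
  rw [h.sigCA_eq hpar, power_const_mul, h.power_combine hN hpar hX a k
    (fun m b ↦ par.innovCoeff m k n b) (fun m ↦ par.β m k) (fun _ ↦ 0)
    (fun m m' b b' ↦ coeffInner_innovCoeff hpar m m' k n b b')
    (fun m b ↦ by rw [coeffInner_pilotCoeff_innovCoeff m k hn]; simp), Complex.norm_real,
    Real.norm_eq_abs, sq_abs, mul_pow, Real.sq_sqrt (hpar.p_nonneg k)]
  simp only [mul_zero, Complex.ofReal_zero, Finset.sum_const_zero, norm_zero]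
  ring

lemma power_sigNS (h : par.IdealRayleigh) (hN : 0 < N) (hpar : par.Admissible)
    (hX : IsSourceFamily P X) (a : Fin M → ℂ) (k : Fin K) {n : ℕ} (hn : par.lam ≤ n) :
    power P (par.sigNS X P a k n) = ∑ m, ‖a m‖ ^ 2 * (N * par.γbar m k * par.σ ^ 2) := by
  rw [h.sigNS_eq, h.power_combine hN hpar hX a k
    (fun m b ↦ par.noiseCoeff m n b) (fun m ↦ par.σ ^ 2) (fun _ ↦ 0)
    (fun m m' b b' ↦ coeffInner_noiseCoeff m m' n b b')
    (fun m b ↦ by rw [coeffInner_pilotCoeff_noiseCoeff m k hn]; simp)]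
  simp

/-- For users with a common pilot instant, the geometric mean of the estimate powers is the
cross-correlation of the estimates up to sign. -/
lemma sqrt_γbar_mul_γbar (h : par.IdealRayleigh) (hN : 0 < N) (hpar : par.Admissible) (m : Fin M)
    {k i : Fin K} (hi : i ∈ par.copilot k) :
    Real.sqrt (par.γbar m k * par.γbar m i) =
      |par.ρ k ((par.lam : ℤ) - par.t k) * par.ρ i ((par.lam : ℤ) - par.t i)| *
        (Real.sqrt (par.pp k * par.pp i) * par.β m k * par.β m i / par.pilotPower m k) := by
  have hD : par.pilotPower m i = par.pilotPower m k := by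
    rw [pilotPower, pilotPower, copilot_congr hi]
  have hpos := hpar.pilotPower_pos m k
  have := (hpar.β_pos m k).le
  have := (hpar.β_pos m i).le
  rw [h.γbar_eq hN hpar, h.γbar_eq hN hpar, hD, ← Real.sqrt_sq (show 0 ≤ |_| * _ by positivity)]
  congr 1
  rw [mul_pow, sq_abs, mul_pow, div_pow, mul_pow, mul_pow,
    Real.sq_sqrt (mul_nonneg (hpar.pp_nonneg k) (hpar.pp_nonneg i))]
  field_simp

/-- The sign lost in the square root is the same at all APs, hence invisible in the modulus of the
combination. -/
lemma norm_sum_sqrt_γbar (h : par.IdealRayleigh) (hN : 0 < N) (hpar : par.Admissible)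
    (a : Fin M → ℂ) {k i : Fin K} (hi : i ∈ par.copilot k) :
    ‖∑ m, star (a m) * (Real.sqrt (par.γbar m k * par.γbar m i) : ℂ)‖ =
      |par.ρ k ((par.lam : ℤ) - par.t k) * par.ρ i ((par.lam : ℤ) - par.t i)| *
        ‖∑ m, star (a m) * ((Real.sqrt (par.pp k * par.pp i) * par.β m k * par.β m i /
          par.pilotPower m k : ℝ) : ℂ)‖ := by
  rw [← abs_abs, ← Real.norm_eq_abs, ← Complex.norm_real, ← norm_mul, Finset.mul_sum]
  congr 1
  refine Finset.sum_congr rfl fun m _ ↦ ?_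
  rw [h.sqrt_γbar_mul_γbar hN hpar m hi, Complex.ofReal_mul]
  ring

/-- The first summand is the coherent interference caused by pilot contamination. -/
lemma power_sigIUI (h : par.IdealRayleigh) (hN : 0 < N) (hpar : par.Admissible)
    (hX : IsSourceFamily P X) (a : Fin M → ℂ) (k i : Fin K) {n : ℕ} (hn : par.lam ≤ n) :
    power P (par.sigIUI X P a k i n) =
      (if i ∈ par.copilot k then (N : ℝ) ^ 2 * (par.p i * par.ρ i ((n : ℤ) - par.lam) ^ 2 *
        ‖∑ m, star (a m) * (Real.sqrt (par.γbar m k * par.γbar m i) : ℂ)‖ ^ 2) else 0)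
      + par.p i * ∑ m, ‖a m‖ ^ 2 * (N * par.γbar m k * par.β m i) := by
  rw [h.sigIUI_eq hpar, power_const_mul, h.power_combine hN hpar hX a k
    (fun m b ↦ par.chanCoeff m i n b) (fun m ↦ par.β m i)
    (fun m ↦ if i ∈ par.copilot k then Real.sqrt (par.pp i) * par.ρ i ((par.lam : ℤ) - par.t i) *
          par.ρ i ((par.lam : ℤ) - n) * par.β m i else 0)
    (fun m m' b b' ↦ by rw [coeffInner_chanCoeff hpar m m' i i n b b', if_pos rfl])
    (fun m b ↦ by rw [coeffInner_pilotCoeff_chanCoeff hpar m k i hn]; split_ifs <;> simp),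
    Complex.norm_real, Real.norm_eq_abs, sq_abs, Real.sq_sqrt (hpar.p_nonneg i), mul_add]
  congr 1
  split_ifs with hi
  · set c := par.ρ k ((par.lam : ℤ) - par.t k) * par.ρ i ((par.lam : ℤ) - par.t i) with hc
    set s : Fin M → ℝ := fun m ↦
      Real.sqrt (par.pp k * par.pp i) * par.β m k * par.β m i / par.pilotPower m k with hs
    have e1 : ∑ m, star (a m) * ((N * (par.lmmseGain m k * (Real.sqrt (par.pp i) *
        par.ρ i ((par.lam : ℤ) - par.t i) * par.ρ i ((par.lam : ℤ) - n) * par.β m i)) : ℝ) : ℂ) =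
        ((N * (par.ρ i ((n : ℤ) - par.lam) * c) : ℝ) : ℂ) * ∑ m, star (a m) * (s m : ℂ) := by
      rw [Finset.mul_sum]
      refine Finset.sum_congr rfl fun m _ ↦ ?_
      have : par.lmmseGain m k * (Real.sqrt (par.pp i) * par.ρ i ((par.lam : ℤ) - par.t i) *
          par.ρ i ((par.lam : ℤ) - n) * par.β m i) = par.ρ i ((n : ℤ) - par.lam) * c * s m := by
        rw [par.ρ_sub_comm i (par.lam : ℤ) n, lmmseGain, hc, hs]
        simp only [Real.sqrt_mul (hpar.pp_nonneg k)]
        ring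
      rw [this]
      push_cast; ring
    rw [e1, h.norm_sum_sqrt_γbar hN hpar a hi, norm_mul, mul_pow, Complex.norm_real,
      Real.norm_eq_abs, sq_abs, mul_pow |c|, sq_abs]
    ring
  · simp

theorem sinr_eq_idealSinr (h : par.IdealRayleigh) (hN : 0 < N) (hpar : par.Admissible)
    (hX : IsSourceFamily P X) (a : Fin M → ℂ) (k : Fin K) {n : ℕ} (hn : par.lam ≤ n) :
    par.sinr X P a k n = par.idealSinr a k n := by
  have h0 : power P (fun _ : Ω ↦ (0 : ℂ)) = 0 := by simp [power]
  rw [sinr, idealSinr, h.sigDS_eq hN hpar hX, h.sigDAC_eq, h.sigTRF_eq, h.sigRRF_eq, h.sigADC_eq,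
    h0, h.power_sigBU hN hpar hX, h.power_sigCA hN hpar hX a k hn, h.power_sigNS hN hpar hX a k hn]
  congr 1
  simp only [h.power_sigIUI hN hpar hX a k _ hn, Finset.sum_add_distrib, norm_star]
  have hco : ∑ i ∈ Finset.univ.erase k, (if i ∈ par.copilot k then
      (N : ℝ) ^ 2 * (par.p i * par.ρ i ((n : ℤ) - par.lam) ^ 2 *
        ‖∑ m, star (a m) * (Real.sqrt (par.γbar m k * par.γbar m i) : ℂ)‖ ^ 2) else 0) =
      (N : ℝ) ^ 2 * ∑ i ∈ (par.copilot k).erase k, par.p i * par.ρ i ((n : ℤ) - par.lam) ^ 2 *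
        ‖∑ m, star (a m) * (Real.sqrt (par.γbar m k * par.γbar m i) : ℂ)‖ ^ 2 := by
    rw [← Finset.sum_filter, Finset.mul_sum]
    refine Finset.sum_congr ?_ fun _ _ ↦ rfl
    ext i; simp
  have hin (i : Fin K) : ∑ m, ‖a m‖ ^ 2 * par.p i * N * par.γbar m k * par.β m i =
      par.p i * ∑ m, ‖a m‖ ^ 2 * (N * par.γbar m k * par.β m i) := by
    rw [Finset.mul_sum]
    exact Finset.sum_congr rfl fun m _ ↦ by ring
  have hns : ∑ m, ‖a m‖ ^ 2 * (N * par.γbar m k * par.σ ^ 2) =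
      par.σ ^ 2 * ∑ m, ‖a m‖ ^ 2 * N * par.γbar m k := by
    rw [Finset.mul_sum]
    exact Finset.sum_congr rfl fun m _ ↦ by ring
  rw [hco, hns]
  simp only [hin]
  rw [← Finset.add_sum_erase _ _ (Finset.mem_univ k)]
  -- beamforming uncertainty and channel aging make up the summand `i = k`
  linear_combination (par.p k * ∑ m, ‖a m‖ ^ 2 * (N * par.γbar m k * par.β m k)) *
    par.ρ_sq_add_ρbar_sq k ((n : ℤ) - par.lam)

end Power

end CFParams.IdealRayleigh

/-! ### Comparison with known closed forms -/

namespace CFParams.IdealRayleigh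

variable {M K N : ℕ} {par : CFParams M K N}

theorem idealSinr_eq_agingRayleigh_sinr (h : par.IdealRayleigh) (hN : 0 < N)
    (hpar : par.Admissible) (a : Fin M → ℂ) (k : Fin K) (n : ℕ) :
    par.idealSinr a k n =
      AgingRayleigh.sinr par.R par.pilotIdx (fun i ↦ par.ρ i ((par.lam : ℤ) - par.t i))
        (fun i ↦ par.ρ i ((n : ℤ) - par.lam)) par.p par.pp (par.σ ^ 2) a k := by
  have hΨ (m : Fin M) : AgingRayleigh.Ψ par.R par.pilotIdx par.pp (par.σ ^ 2) m k =
      (((par.pilotPower m k)⁻¹ : ℝ) : ℂ) • 1 := by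
    rw [← ofReal_smul_one_inv (hpar.pilotPower_pos m k).ne', AgingRayleigh.Ψ]
    congr 1
    simp [h.uncorrelated, pilotPower, add_smul, Finset.sum_smul, smul_smul, copilot,
      -Complex.coe_smul]
  have hQ (m : Fin M) : AgingRayleigh.Q par.R par.pilotIdx
      (fun i ↦ par.ρ i ((par.lam : ℤ) - par.t i)) par.pp (par.σ ^ 2) m k =
      (par.γbar m k : ℂ) • 1 := by
    rw [AgingRayleigh.Q, hΨ, h.uncorrelated, h.γbar_eq hN hpar]
    simp only [smul_mul_smul_comm, Matrix.one_mul, smul_smul, ← Complex.ofReal_mul]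
    congr 2
    ring
  have hQR (m : Fin M) (i : Fin K) : (AgingRayleigh.Q par.R par.pilotIdx
      (fun i ↦ par.ρ i ((par.lam : ℤ) - par.t i)) par.pp (par.σ ^ 2) m k * par.R m i).trace.re =
      N * par.γbar m k * par.β m i := by
    rw [hQ, h.uncorrelated, smul_mul_smul_comm, Matrix.one_mul, Matrix.trace_smul,
      Matrix.trace_one, Fintype.card_fin, smul_eq_mul, ← Complex.ofReal_mul,
      ← Complex.ofReal_natCast, ← Complex.ofReal_mul, Complex.ofReal_re]
    ring
  have hQtr (m : Fin M) : (AgingRayleigh.Q par.R par.pilotIdx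
      (fun i ↦ par.ρ i ((par.lam : ℤ) - par.t i)) par.pp (par.σ ^ 2) m k).trace =
      ((N * par.γbar m k : ℝ) : ℂ) := by
    rw [hQ, Matrix.trace_smul, Matrix.trace_one, Fintype.card_fin]
    push_cast
    simp [mul_comm]
  have hQbar (i : Fin K) (hi : i ∈ par.copilot k) :
      ‖∑ m, star (a m) * (AgingRayleigh.Qbar par.R par.pilotIdx
        (fun i ↦ par.ρ i ((par.lam : ℤ) - par.t i)) par.pp (par.σ ^ 2) m k i).trace‖ =
      N * ‖∑ m, star (a m) * (Real.sqrt (par.γbar m k * par.γbar m i) : ℂ)‖ := by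
    set c := par.ρ k ((par.lam : ℤ) - par.t k) * par.ρ i ((par.lam : ℤ) - par.t i) with hc
    set s : Fin M → ℝ := fun m ↦
      Real.sqrt (par.pp k * par.pp i) * par.β m k * par.β m i / par.pilotPower m k with hs
    have e1 : ∑ m, star (a m) * (AgingRayleigh.Qbar par.R par.pilotIdx
        (fun i ↦ par.ρ i ((par.lam : ℤ) - par.t i)) par.pp (par.σ ^ 2) m k i).trace =
        ((N * c : ℝ) : ℂ) * ∑ m, star (a m) * (s m : ℂ) := by
      rw [Finset.mul_sum]
      refine Finset.sum_congr rfl fun m _ ↦ ?_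
      rw [AgingRayleigh.Qbar, hΨ, h.uncorrelated, h.uncorrelated, hc, hs]
      simp only [smul_mul_smul_comm, Matrix.one_mul, smul_smul, ← Complex.ofReal_mul,
        Matrix.trace_smul, Matrix.trace_one, Fintype.card_fin, smul_eq_mul]
      push_cast
      ring
    rw [e1, h.norm_sum_sqrt_γbar hN hpar a hi, norm_mul, Complex.norm_real, Real.norm_eq_abs,
      abs_mul, Nat.abs_cast, mul_assoc]
  rw [idealSinr, AgingRayleigh.sinr]
  simp only [hQtr, hQR, Complex.ofReal_re, norm_star]
  congr 1
  · ring
  congr 1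
  · congr 1
    · refine Finset.sum_congr rfl fun i _ ↦ ?_
      rw [Finset.mul_sum]
      exact Finset.sum_congr rfl fun m _ ↦ by ring
    · rw [Finset.mul_sum]
      refine Finset.sum_congr rfl fun i hi ↦ ?_
      rw [hQbar i (Finset.mem_of_mem_erase hi)]
      ring
  · congr 1
    exact Finset.sum_congr rfl fun m _ ↦ by ring

theorem idealSinr_eq_ngo_sinr {par : CFParams M K 1} (h : par.IdealRayleigh)
    (hpar : par.Admissible) (k : Fin K) (n : ℕ) {L ρu ρp : ℝ} {η : Fin K → ℝ}
    {e : Fin par.τp → EuclideanSpace ℂ (Fin par.τp)} (hL : L ≠ 0) (he : Orthonormal ℂ e)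
    (hρn : ∀ i, par.ρ i ((n : ℤ) - par.lam) = 1)
    (hρt : ∀ i, par.ρ i ((par.lam : ℤ) - par.t i) = 1)
    (hp : ∀ i, par.p i = par.σ ^ 2 * (ρu * η i))
    (hpp : ∀ i, par.pp i = par.σ ^ 2 * (par.τp * ρp)) :
    par.idealSinr (fun _ ↦ 1 / (L : ℂ)) k n =
      Ngo.sinr (fun i ↦ e (par.pilotIdx i)) par.β ρu ρp η k := by
  have hσ := hpar.σ_pos
  have hin (i : Fin K) : ‖inner ℂ (e (par.pilotIdx k)) (e (par.pilotIdx i))‖ ^ 2 =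
      if i ∈ par.copilot k then 1 else 0 := by
    rw [orthonormal_iff_ite.1 he]
    simp only [copilot, Finset.mem_filter, Finset.mem_univ, true_and,
      eq_comm (a := par.pilotIdx k)]
    split_ifs <;> simp
  have hsum (f : Fin K → ℝ) :
      ∑ i, f i * ‖inner ℂ (e (par.pilotIdx k)) (e (par.pilotIdx i))‖ ^ 2 =
        ∑ i ∈ par.copilot k, f i := by
    simp only [hin, mul_ite, mul_one, mul_zero, Finset.sum_ite_mem, Finset.univ_inter]
  have hsum' (f : Fin K → ℝ) :
      ∑ i ∈ Finset.univ.erase k,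
        f i * ‖inner ℂ (e (par.pilotIdx k)) (e (par.pilotIdx i))‖ ^ 2 =
        ∑ i ∈ (par.copilot k).erase k, f i := by
    simp only [hin, mul_ite, mul_one, mul_zero, Finset.sum_ite_mem]
    congr 1
    ext i; simp
  have hD (m : Fin M) : par.pilotPower m k =
      par.σ ^ 2 * (par.τp * ρp * ∑ i ∈ par.copilot k, par.β m i + 1) := by
    simp only [pilotPower, hpp, mul_assoc, ← Finset.mul_sum]
    ring
  have hD0 (m : Fin M) : par.τp * ρp * ∑ i ∈ par.copilot k, par.β m i + 1 ≠ 0 := fun h0 ↦ by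
    have := hpar.pilotPower_pos m k
    rw [hD, h0, mul_zero] at this
    exact this.false
  have hγ (m : Fin M) : Ngo.γ (fun i ↦ e (par.pilotIdx i)) par.β ρp m k = par.γbar m k := by
    have := hD0 m
    rw [Ngo.γ, hsum, h.γbar_eq one_pos hpar, hρt, hpp, hD]
    field_simp
  have hsq (m : Fin M) (i : Fin K) (hi : i ∈ par.copilot k) :
      Real.sqrt (par.γbar m k * par.γbar m i) = par.γbar m k * (par.β m i / par.β m k) := by
    have hβ := (hpar.β_pos m k).ne'
    rw [h.sqrt_γbar_mul_γbar one_pos hpar m hi, hρt, hρt, hpp i, ← hpp k,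
      Real.sqrt_mul_self (hpar.pp_nonneg k), h.γbar_eq one_pos hpar, hρt]
    simp only [mul_one, abs_one, one_pow, one_mul]
    field_simp
  have hco (f : Fin M → ℝ) : ‖∑ m, star (1 / (L : ℂ)) * (f m : ℂ)‖ ^ 2 =
      (∑ m, f m) ^ 2 / L ^ 2 := by
    rw [← Finset.mul_sum, ← Complex.ofReal_sum, norm_mul, norm_star, Complex.norm_real, norm_div,
      Complex.norm_real, mul_pow, div_pow, Real.norm_eq_abs, Real.norm_eq_abs, sq_abs, sq_abs]
    simp
    ring
  have hn : ‖star (1 / (L : ℂ))‖ ^ 2 = 1 / L ^ 2 := by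
    rw [norm_star, norm_div, Complex.norm_real, div_pow, Real.norm_eq_abs, sq_abs]
    simp
  have hnum : par.p k * par.ρ k ((n : ℤ) - par.lam) ^ 2 *
      ‖∑ m, star (1 / (L : ℂ)) * (((1 : ℕ) * par.γbar m k : ℝ) : ℂ)‖ ^ 2 =
      par.σ ^ 2 / L ^ 2 * (ρu * η k * (∑ m, par.γbar m k) ^ 2) := by
    rw [hco, hρn, hp]
    simp only [Nat.cast_one, one_mul]
    ring
  rw [idealSinr, Ngo.sinr, hnum]
  simp only [hγ, hsum']
  -- the common factor `σ² / L²` cancels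
  refine Eq.trans ?_ (mul_div_mul_left _ _ (show par.σ ^ 2 / L ^ 2 ≠ 0 by positivity))
  congr 1
  have h1 : ∑ i, ∑ m, ‖star (1 / (L : ℂ))‖ ^ 2 * par.p i * (1 : ℕ) * par.γbar m k * par.β m i =
      par.σ ^ 2 / L ^ 2 * (ρu * ∑ i, η i * ∑ m, par.γbar m k * par.β m i) := by
    simp only [hn, hp, Finset.mul_sum]
    refine Finset.sum_congr rfl fun i _ ↦ Finset.sum_congr rfl fun m _ ↦ ?_
    push_cast; ring
  have h2 : ((1 : ℕ) : ℝ) ^ 2 * ∑ i ∈ (par.copilot k).erase k,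
      par.p i * par.ρ i ((n : ℤ) - par.lam) ^ 2 *
        ‖∑ m, star (1 / (L : ℂ)) * (Real.sqrt (par.γbar m k * par.γbar m i) : ℂ)‖ ^ 2 =
      par.σ ^ 2 / L ^ 2 * (ρu * ∑ i ∈ (par.copilot k).erase k,
        η i * (∑ m, par.γbar m k * (par.β m i / par.β m k)) ^ 2) := by
    simp only [hco, Finset.mul_sum]
    refine Finset.sum_congr rfl fun i hi ↦ ?_
    rw [hρn, hp]
    simp only [hsq _ i (Finset.mem_of_mem_erase hi)]
    push_cast; ring
  have h3 : par.σ ^ 2 * ∑ m, ‖star (1 / (L : ℂ))‖ ^ 2 * (1 : ℕ) * par.γbar m k =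
      par.σ ^ 2 / L ^ 2 * ∑ m, par.γbar m k := by
    simp only [hn, Finset.mul_sum]
    refine Finset.sum_congr rfl fun m _ ↦ ?_
    push_cast; ring
  rw [h1, h2, h3]
  ring

end CFParams.IdealRayleigh

theorem corollary2 {M K N : ℕ} (hN : 0 < N) (par : CFParams M K N)
    (hpar : par.Admissible) (hideal : par.IdealRayleigh)
    {Ω : Type*} [MeasurableSpace Ω] (P : MeasureTheory.Measure Ω)
    [MeasureTheory.IsProbabilityMeasure P]
    (X : Src M K N → Ω → ℂ) (hX : IsSourceFamily P X)
    (a : Fin M → ℂ) (k : Fin K) (n : ℕ) (hn : par.lam ≤ n) (hnc : n ≤ par.τc) :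
    par.SinrWellDefined X P a k n ∧
    par.sinr X P a k n = par.idealSinr a k n ∧
    par.idealSinr a k n =
      AgingRayleigh.sinr par.R par.pilotIdx (fun i => par.ρ i ((par.lam : ℤ) - par.t i))
        (fun i => par.ρ i ((n : ℤ) - par.lam)) par.p par.pp (par.σ ^ 2) a k ∧
    (∀ (L ρu ρp : ℝ) (η : Fin K → ℝ) (e : Fin par.τp → EuclideanSpace ℂ (Fin par.τp)),
      N = 1 → L ≠ 0 → Orthonormal ℂ e →
      (∀ i, par.ρ i ((n : ℤ) - par.lam) = 1) →
      (par.lam < n ∨ ∀ i, par.ρ i ((par.lam : ℤ) - par.t i) = 1) →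
      (∀ m, a m = 1 / (L : ℂ)) →
      (∀ i, par.p i = par.σ ^ 2 * (ρu * η i)) →
      (∀ i, par.pp i = par.σ ^ 2 * (par.τp * ρp)) →
      par.idealSinr a k n =
        Ngo.sinr (fun i => e (par.pilotIdx i)) par.β ρu ρp η k) := by
  refine ⟨hideal.sinrWellDefined hN hpar hX a k n, hideal.sinr_eq_idealSinr hN hpar hX a k hn,
    hideal.idealSinr_eq_agingRayleigh_sinr hN hpar a k n, ?_⟩
  intro L ρu ρp η e hN1 hL he hρn hρt ha hp hpp
  subst hN1
  obtain rfl : a = fun _ ↦ 1 / (L : ℂ) := funext ha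
  refine hideal.idealSinr_eq_ngo_sinr hpar k n hL he hρn ?_ hp hpp
  rcases hρt with hlt | hρt
  · -- at a later data instant, `ρ = 1` forces a zero Doppler shift
    exact fun i ↦ par.ρ_eq_one_of_ne_zero (by omega) (hρn i) _
  · exact hρt
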